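/- Conventions. An arc is a topological space homeomorphic to $[0,1]$; a possibly degenerate arc is an arc or a singleton. For an arc $J$ let $e(J)$ be its set of two endpoints, and let $e(\{a\})=\{a\}$. A set $A$ is arc-connected if any two points $x\ne y$ of $A$ are the endpoints of an arc $J\subset A$; a space is locally arc-connected if its arc-connected open subsets form a base of its topology. For a metrizable space $X$, $\mathcal K(X)$ is the space of nonempty compact subsets of $X$ with the Vietoris (Hausdorff-metric) topology, and $\hat{\mathcal J}(X)\subset\mathcal K(X)$ is the subspace of possibly degenerate arcs. $E_X\subset X^2$ is the set of pairs $(x,y)$ with $e(J)=\{x,y\}$ for some $J\in\hat{\mathcal J}(X)$; it is an equivalence relation, whose classes are the arc-components of $X$. For $S\subset X$, an arc-lifting of $S$ in $X$ is a map $\psi:S^2\cap E_X\to\hat{\mathcal J}(X)$ with $e(\psi(x,y))=\{x,y\}$ for all $(x,y)\in S^2\cap E_X$; it is Borel if it is measurable for the Borel $\sigma$-algebras of $S^2\cap E_X$ (as a subspace of $X^2$) and of $\hat{\mathcal J}(X)$. An arc-lifting of $X$ is an arc-lifting of $X$ in $X$. For a metric space $(X,d)$ put $$\delta(x,y)=\inf\{\operatorname{diam}(H)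 : H\subset X \text{ arc-connected},\ \{x,y\}\subset H\}\in[0,\infty],\qquad \inf\emptyset=\infty;$$ the arc-topology $\tau$ of $X$ is the topology generated by the open $\delta$-balls of finite radius. Theorem. (1) Let $M$ be a complete, arc-connected and locally arc-connected metric space. Then for every separable subset $S$ of $M$ there is a separable subspace $N\supset S$ of $M$ such that $S^2\subset E_N$ (any two distinct points of $S$ are the endpoints of an arc contained in $N$) and $S$ admits a Borel arc-lifting in $N$. (2) Let $X$ be a Polish space, $d$ any metric compatible with its topology, and $\tau$ the arc-topology defined by $(X,d)$. Then every $\tau$-separable subset $S$ of an arc-component of $X$ admits a Borel arc-lifting in $X$, where "Borel" refers to the original Polish topology of $X$. (3) Every locally connected Polish space admits a Borel arc-lifting. -/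

import Mathlib

open Set Topology TopologicalSpace
open scoped ENNReal

namespace ArcLift

/-- An arc: a set homeomorphic to the unit interval `[0,1]`. -/
def IsArc {X : Type*} [TopologicalSpace X] (J : Set X) : Prop :=
  Nonempty (unitInterval ≃ₜ J)

/-- A possibly degenerate arc: an arc or a singleton. -/
def IsPDArc {X : Type*} [TopologicalSpace X] (J : Set X) : Prop :=
  IsArc J ∨ ∃ a, J = {a}

/-- The set `e(J)` of endpoints of a possibly degenerate arc `J`. The endpoints of an arc are the
values at `0` of its parametrizations (the value at `1` is the value at `0` of the reversed
parametrization); the endpoint of `{a}` is `a`. -/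
def endpoints {X : Type*} [TopologicalSpace X] (J : Set X) : Set X :=
  {z | J = {z} ∨ ∃ h : unitInterval ≃ₜ J, (h 0 : X) = z}

/-- The points `x` and `y` are the endpoints of a possibly degenerate arc contained in `A`. -/
def ArcJoinedIn {X : Type*} [TopologicalSpace X] (A : Set X) (x y : X) : Prop :=
  ∃ J : Set X, J ⊆ A ∧ IsPDArc J ∧ endpoints J = {x, y}

/-- Arc-connected subsets. -/
def IsArcConnected {X : Type*} [TopologicalSpace X] (A : Set X) : Prop :=
  ∀ x ∈ A, ∀ y ∈ A, ArcJoinedIn A x y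

/-- Local arc-connectedness: the arc-connected open sets form a base of the topology. -/
def IsLocallyArcConnected (X : Type*) [TopologicalSpace X] : Prop :=
  ∀ (x : X) (U : Set X), IsOpen U → x ∈ U →
    ∃ V : Set X, IsOpen V ∧ x ∈ V ∧ V ⊆ U ∧ IsArcConnected V

/-- The arc-connection relation `E_X` of the space `X`, as a subset of `X × X`. -/
def arcRel (X : Type*) [TopologicalSpace X] : Set (X × X) :=
  {p | ArcJoinedIn univ p.1 p.2}

/-- The arc-component of `x` in `X`. -/
def arcComponent {X : Type*} [TopologicalSpace X] (x : X) : Set X :=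
  {y | (x, y) ∈ arcRel X}

/-- Borel maps between topological spaces. -/
def IsBorelMap {Y Z : Type*} [TopologicalSpace Y] [TopologicalSpace Z] (f : Y → Z) : Prop :=
  @Measurable Y Z (borel Y) (borel Z) f

/-- `ψ` is an arc-lifting of `S` in `X`: it assigns to every pair `(x, y) ∈ S² ∩ E_X` a possibly
degenerate arc of `X` with set of endpoints `{x, y}`. -/
def IsArcLifting {X : Type*} [TopologicalSpace X] (S : Set X)
    (ψ : ↥((S ×ˢ S) ∩ arcRel X) → NonemptyCompacts X) : Prop :=
  ∀ p, IsPDArc (ψ p : Set X) ∧ endpoints (ψ p : Set X) = {p.1.1, p.1.2}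

/-- `S` admits a Borel arc-lifting in `X`. The domain `S² ∩ E_X` is a subspace of `X × X`, and the
space of nonempty compact subsets of `X` carries the Vietoris topology (the topology of the
Hausdorff distance when `X` is metric). -/
def HasBorelArcLifting (X : Type*) [TopologicalSpace X] (S : Set X) : Prop :=
  ∃ ψ : ↥((S ×ˢ S) ∩ arcRel X) → NonemptyCompacts X, IsArcLifting S ψ ∧ IsBorelMap ψ

/-- The canonical arc-pseudo-metric of a metric space, with values in `[0, ∞]`: the infimum of the
diameters of the arc-connected sets that contain `x` and `y`. -/
noncomputable def arcEDist {X : Type*} [MetricSpace X] (x y : X) : ℝ≥0∞ :=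
  ⨅ (H : Set X) (_ : IsArcConnected H ∧ {x, y} ⊆ H), Metric.ediam H

/-- The canonical arc-topology: the topology generated by the open balls of finite radius of the
canonical arc-pseudo-metric. -/
@[reducible]
def arcTopology (X : Type*) [MetricSpace X] : TopologicalSpace X :=
  generateFrom {B | ∃ (x : X) (r : ℝ≥0∞), r ≠ ∞ ∧ B = {y | arcEDist x y < r}}

end ArcLift

/-! ### Arcs from paths whose fibres are intervals. -/

namespace ArcLift

/-! All three statements reduce to paths. Suppose each `x` in `S` has a path `c x` ending at `x`,
Borel in `x` at each fixed time, and starting at a point that depends only on the arc-component of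
`x`. Then `c x` reversed, followed by `c y`, joins `x` to `y` measurably, and it remains to extract
an arc by a Borel procedure.

The extraction is a loop erasure. For each `q` of a dense sequence of times, one deletes the open
interval between the first and last visits to the point where the path last returns to its past
before `q`. On the closed set `C` of surviving times a value is repeated only at the two ends of a
gap, so `f ∘ floorIn C` is continuous with interval fibres and its range is an arc or a point
(`isPDArc_image_iInter_erasure`). Each deletion depends measurably on the path, because the
conditions involved say that a Carathéodory function has a zero in a compact set
(`measurableSet_image_iInter_erasure_inter`).

The paths come from a sequence `D` that is `δ`-dense for `S`: take the least-index approximations of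
`x` within `1 / (n + 1)` and concatenate short paths between them (`exists_measurable_paths`). The
choice is Borel as soon as the traces on `S` of the `δ`-balls around the points of `D` are Borel.
When small `δ`-balls are neighbourhoods, all `δ`-balls are open; this holds in locally arc-connected
spaces, and in locally connected complete ones by `joinedIn_closure`. In a general Polish space the
balls are analytic, and Lusin separation makes their traces on `S` Borel
(`measurableSet_arcEDist_lt`). -/

theorem homeomorph_unitInterval_zero (φ : unitInterval ≃ₜ unitInterval) : φ 0 = 0 ∨ φ 0 = 1 := by
  rcases φ.continuous.strictMono_of_inj φ.injective with h | h
  · left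
    obtain ⟨t, ht⟩ := φ.surjective 0
    exact le_antisymm ((h.monotone unitInterval.nonneg').trans ht.le) unitInterval.nonneg'
  · right
    obtain ⟨t, ht⟩ := φ.surjective 1
    exact le_antisymm unitInterval.le_one' (ht.ge.trans (h.antitone unitInterval.nonneg'))

/-- Two parametrizations differ by a self-homeomorphism of the interval, which is strictly monotone
or antitone and hence preserves `{0, 1}`. -/
theorem endpoints_of_homeomorph {X : Type*} [TopologicalSpace X] {J : Set X}
    (h : unitInterval ≃ₜ J) : endpoints J = {(h 0 : X), (h 1 : X)} := by
  ext z
  constructor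
  · rintro (hJ | ⟨k, rfl⟩)
    · have : ((h 0 : J) : X) ∈ ({z} : Set X) := hJ ▸ (h 0).2
      exact Or.inl (mem_singleton_iff.1 this).symm
    · rcases homeomorph_unitInterval_zero (k.trans h.symm) with h0 | h0
      · left
        have : k 0 = h 0 := h.symm_apply_eq.1 h0
        rw [this]
      · right
        have : k 0 = h 1 := h.symm_apply_eq.1 h0
        rw [this]; rfl
  · rintro (rfl | rfl)
    · exact Or.inr ⟨h, rfl⟩
    · exact Or.inr ⟨unitInterval.symmHomeomorph.trans h, by simp⟩

theorem isPDArc_range_of_injective {X : Type*} [TopologicalSpace X] [T2Space X]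
    {h : unitInterval → X} (hc : Continuous h) (hi : Function.Injective h) :
    IsPDArc (range h) ∧ endpoints (range h) = {h 0, h 1} := by
  let e := (hc.isClosedEmbedding hi).isEmbedding.toHomeomorph
  exact ⟨Or.inl ⟨e⟩, endpoints_of_homeomorph e⟩

theorem endpoints_singleton {X : Type*} [TopologicalSpace X] (a : X) :
    endpoints ({a} : Set X) = {a} := by
  ext z
  constructor
  · rintro (h | ⟨h, rfl⟩)
    · exact (singleton_eq_singleton_iff.1 h).symm
    · exact (h 0).2
  · rintro rfl
    exact Or.inl rfl

/-- How far `F` has moved away from `F q` between the times `q` and `t`. -/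
noncomputable def excursion {X : Type*} [MetricSpace X] (F : unitInterval → X)
    (q t : unitInterval) : ℝ :=
  sSup ((fun s : unitInterval ↦ dist (F q) (F (q ⊔ (s ⊓ t)))) '' univ)

section excursion

variable {X : Type*} [MetricSpace X] {F : unitInterval → X}

/-- Clamping `s` to `q ⊔ (s ⊓ t)` lets the supremum run over a compact set independent of `t`, so
that continuity of suprema over a fixed compact set applies. -/
theorem continuous_excursion (hF : Continuous F) (q : unitInterval) :
    Continuous (excursion F q) := by
  refine isCompact_univ.continuous_sSup
    (f := fun t s : unitInterval ↦ dist (F q) (F (q ⊔ (s ⊓ t)))) ?_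
  change Continuous fun p : unitInterval × unitInterval ↦ dist (F q) (F (q ⊔ (p.2 ⊓ p.1)))
  fun_prop

theorem bddAbove_excursion (hF : Continuous F) (q t : unitInterval) :
    BddAbove ((fun s : unitInterval ↦ dist (F q) (F (q ⊔ (s ⊓ t)))) '' univ) :=
  (isCompact_univ.image (by fun_prop)).bddAbove

theorem dist_le_excursion (hF : Continuous F) {q t : unitInterval} (h : q ≤ t) :
    dist (F q) (F t) ≤ excursion F q t :=
  le_csSup (bddAbove_excursion hF q t) ⟨t, trivial, by simp [h]⟩

theorem excursion_mono (hF : Continuous F) (q : unitInterval) : Monotone (excursion F q) := by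
  intro s t hst
  refine csSup_le (univ_nonempty.image _) ?_
  rintro _ ⟨u, -, rfl⟩
  refine le_csSup (bddAbove_excursion hF q t) ⟨u ⊓ s, trivial, ?_⟩
  simp [hst]

theorem excursion_eq_zero {q t : unitInterval} (h : t ≤ q) : excursion F q t = 0 := by
  have : ∀ s : unitInterval, q ⊔ (s ⊓ t) = q := fun s ↦ sup_eq_left.2 (inf_le_right.trans h)
  simp [excursion, this, image_univ]

theorem excursion_eq (hF : ∀ s u t, s ≤ u → u ≤ t → F s = F t → F u = F s) {s t : unitInterval}
    (hst : s ≤ t) (h : F s = F t) (q : unitInterval) : excursion F q s = excursion F q t := by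
  unfold excursion
  congr 1
  refine image_congr fun u _ ↦ ?_
  have hc : ∀ u, s ≤ u → u ≤ t → F u = F s := fun u h1 h2 ↦ hF s u t h1 h2 h
  congr 1
  rcases le_total u s with hu | hu
  · rw [inf_eq_left.2 hu, inf_eq_left.2 (hu.trans hst)]
  · rw [inf_eq_right.2 hu]
    have h1 : s ≤ u ⊓ t := le_inf hu hst
    rcases le_total t q with hq | hq
    · rw [sup_eq_left.2 (hst.trans hq), sup_eq_left.2 (inf_le_right.trans hq)]
    · rw [hc _ le_sup_right (sup_le hq hst),
        hc _ (h1.trans le_sup_right) (sup_le hq inf_le_right)]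

/-- A monotone function that is constant exactly where `F` is. -/
noncomputable def clock (F : unitInterval → X) (t : unitInterval) : ℝ :=
  ∑' n : ℕ, (1 / 2 : ℝ) ^ n * min 1 (excursion F (denseSeq unitInterval n) t)

theorem excursion_nonneg (hF : Continuous F) (q t : unitInterval) : 0 ≤ excursion F q t := by
  rw [← excursion_eq_zero (F := F) (q := q) (t := 0) unitInterval.nonneg']
  exact excursion_mono hF q unitInterval.nonneg'

theorem norm_clock_term_le (hF : Continuous F) (n : ℕ) (t : unitInterval) :
    ‖(1 / 2 : ℝ) ^ n * min 1 (excursion F (denseSeq unitInterval n) t)‖ ≤ (1 / 2 : ℝ) ^ n := by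
  have h := excursion_nonneg hF (denseSeq unitInterval n) t
  rw [Real.norm_of_nonneg (by positivity)]
  exact mul_le_of_le_one_right (by positivity) (min_le_left _ _)

theorem summable_clock (hF : Continuous F) (t : unitInterval) :
    Summable fun n : ℕ ↦ (1 / 2 : ℝ) ^ n * min 1 (excursion F (denseSeq unitInterval n) t) :=
  Summable.of_norm_bounded summable_geometric_two fun n ↦ norm_clock_term_le hF n t

theorem continuous_clock (hF : Continuous F) : Continuous (clock F) := by
  refine continuous_tsum (fun n ↦ ?_) summable_geometric_two (norm_clock_term_le hF)
  have := continuous_excursion hF (denseSeq unitInterval n)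
  fun_prop

theorem clock_mono (hF : Continuous F) : Monotone (clock F) := by
  intro s t hst
  refine (summable_clock hF s).tsum_le_tsum (fun n ↦ ?_) (summable_clock hF t)
  gcongr
  exact excursion_mono hF _ hst

theorem clock_eq (hF : ∀ s u t, s ≤ u → u ≤ t → F s = F t → F u = F s) {s t : unitInterval}
    (hst : s ≤ t) (h : F s = F t) : clock F s = clock F t := by
  simp only [clock, excursion_eq hF hst h]

/-- A point `q` of the dense sequence just after `s` still has `F q ≠ F t`; its excursion vanishes
at `s` and is positive at `t`, so one term of the series increases strictly. -/
theorem clock_lt (hF : Continuous F) {s t : unitInterval} (hst : s ≤ t) (h : F s ≠ F t) :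
    clock F s < clock F t := by
  have hst' : s < t := lt_of_le_of_ne hst (fun e ↦ h (e ▸ rfl))
  have hU : IsOpen {u | F u ≠ F t} := isOpen_ne_fun hF continuous_const
  obtain ⟨v, hsv, hv⟩ := exists_Ico_subset_of_mem_nhds (hU.mem_nhds h) ⟨t, hst'⟩
  obtain ⟨n, hn⟩ := (denseRange_denseSeq unitInterval).exists_mem_open
    (isOpen_Ioo (a := s) (b := min v t)) (nonempty_Ioo.2 (lt_min hsv hst'))
  set q := denseSeq unitInterval n with hq
  have hqv : F q ≠ F t := hv ⟨hn.1.le, hn.2.trans_le (min_le_left _ _)⟩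
  have hqt : q ≤ t := hn.2.le.trans (min_le_right _ _)
  refine (summable_clock hF s).tsum_lt_tsum (i := n) (fun m ↦ ?_) ?_ (summable_clock hF t)
  · gcongr
    exact excursion_mono hF _ hst
  · rw [← hq, excursion_eq_zero hn.1.le]
    have : 0 < excursion F q t := (dist_pos.2 hqv).trans_le (dist_le_excursion hF hqt)
    have h2 : (0 : ℝ) < min 1 (excursion F q t) := lt_min one_pos this
    rw [min_eq_right zero_le_one, mul_zero]
    positivity

theorem clock_eq_iff (hc : Continuous F) (hF : ∀ s u t, s ≤ u → u ≤ t → F s = F t → F u = F s)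
    {s t : unitInterval} : clock F s = clock F t ↔ F s = F t := by
  wlog hst : s ≤ t generalizing s t
  · rw [eq_comm, this (le_of_not_ge hst), eq_comm]
  exact ⟨fun h ↦ by_contra fun h' ↦ (clock_lt hc hst h').ne h, clock_eq hF hst⟩

/-- The clock, normalized to a surjection `g` of the interval, has the same fibres as `F`. Being a
quotient map by compactness, it turns `F` into an injective path with the same range. -/
theorem isPDArc_range (hc : Continuous F)
    (hF : ∀ s u t, s ≤ u → u ≤ t → F s = F t → F u = F s) :
    IsPDArc (range F) ∧ endpoints (range F) = {F 0, F 1} := by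
  by_cases h01 : F 0 = F 1
  · have hr : range F = {F 0} := by
      ext z
      constructor
      · rintro ⟨t, rfl⟩
        exact hF 0 t 1 unitInterval.nonneg' unitInterval.le_one' h01
      · rintro rfl
        exact mem_range_self 0
    rw [hr, ← h01, endpoints_singleton]
    exact ⟨Or.inr ⟨_, rfl⟩, by simp⟩
  have hg := clock_lt hc unitInterval.nonneg' h01
  set L := clock F 1 - clock F 0 with hL
  have hLpos : 0 < L := sub_pos.2 hg
  have hmem : ∀ t, (clock F t - clock F 0) / L ∈ unitInterval := fun t ↦ by
    have h1 := clock_mono hc (unitInterval.nonneg' (t := t))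
    have h2 := clock_mono hc (unitInterval.le_one' (t := t))
    exact ⟨div_nonneg (sub_nonneg.2 h1) hLpos.le, (div_le_one hLpos).2 (by linarith)⟩
  let g : unitInterval → unitInterval := fun t ↦ ⟨(clock F t - clock F 0) / L, hmem t⟩
  have hgc : Continuous g :=
    Continuous.subtype_mk (((continuous_clock hc).sub continuous_const).div_const _) _
  have hg0 : g 0 = 0 := Subtype.ext (by simp [g])
  have hg1 : g 1 = 1 := Subtype.ext (by simp [g, ← hL, hLpos.ne'])
  have hgs : Function.Surjective g := fun y ↦ by
    have := intermediate_value_univ 0 1 hgc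
    rw [hg0, hg1] at this
    exact this ⟨unitInterval.nonneg', unitInterval.le_one'⟩
  have hgi : ∀ s t, g s = g t ↔ F s = F t := fun s t ↦ by
    rw [← clock_eq_iff hc hF]
    simp [g, Subtype.ext_iff, div_left_inj' hLpos.ne']
  have hq : IsQuotientMap g := hgc.isClosedMap.isQuotientMap hgc hgs
  let h : unitInterval → X := fun y ↦ F (Function.surjInv hgs y)
  have hhg : ∀ t, h (g t) = F t := fun t ↦ (hgi _ _).1 (Function.surjInv_eq hgs _)
  have hhc : Continuous h := by
    rw [hq.continuous_iff]
    exact hc.congr fun t ↦ (hhg t).symm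
  have hhi : Function.Injective h := by
    intro y z hyz
    obtain ⟨s, rfl⟩ := hgs y
    obtain ⟨t, rfl⟩ := hgs z
    rw [hhg, hhg] at hyz
    exact (hgi s t).2 hyz
  have hr : range h = range F := by
    rw [← hgs.range_comp h]
    exact congrArg range (funext hhg)
  have := isPDArc_range_of_injective hhc hhi
  rwa [hr, ← hg0, ← hg1, hhg, hhg] at this

end excursion

theorem ArcJoinedIn.joinedIn {X : Type*} [TopologicalSpace X] {A : Set X} {x y : X}
    (h : ArcJoinedIn A x y) : JoinedIn A x y := by
  obtain ⟨J, hJA, (⟨⟨e⟩⟩ | ⟨a, rfl⟩), he⟩ := h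
  · rw [endpoints_of_homeomorph e] at he
    have hj : JoinedIn A (e 0 : X) (e 1 : X) :=
      ⟨⟨⟨fun t ↦ (e t : X), by fun_prop⟩, rfl, rfl⟩, fun t ↦ hJA (e t).2⟩
    rcases pair_eq_pair_iff.1 he with ⟨h0, h1⟩ | ⟨h0, h1⟩
    · rwa [h0, h1] at hj
    · rw [h0, h1] at hj
      exact hj.symm
  · rw [endpoints_singleton] at he
    have hx : x = a := by simpa using (he.symm ▸ mem_insert x {y} : x ∈ ({a} : Set X))
    have hy : y = a := by
      simpa using (he.symm ▸ mem_insert_of_mem x rfl : y ∈ ({a} : Set X))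
    subst hx hy
    exact JoinedIn.refl (hJA rfl)

end ArcLift

/-! ### Loop erasure of a path. -/

namespace ArcLift

section floor

/-- The last point of `C` before `t`. -/
noncomputable def floorIn (C : Set unitInterval) (t : unitInterval) : unitInterval :=
  sSup (C ∩ Iic t)

/-- The first point of `C` after `t`. -/
noncomputable def ceilIn (C : Set unitInterval) (t : unitInterval) : unitInterval :=
  sInf (C ∩ Ici t)

variable {C : Set unitInterval}

theorem floorIn_mem (hC : IsClosed C) (h0 : 0 ∈ C) (t : unitInterval) :
    floorIn C t ∈ C ∩ Iic t :=
  (hC.inter isClosed_Iic).isCompact.sSup_mem ⟨0, h0, unitInterval.nonneg'⟩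

theorem ceilIn_mem (hC : IsClosed C) (h1 : 1 ∈ C) (t : unitInterval) :
    ceilIn C t ∈ C ∩ Ici t :=
  (hC.inter isClosed_Ici).isCompact.sInf_mem ⟨1, h1, unitInterval.le_one'⟩

theorem le_floorIn {u t : unitInterval} (hu : u ∈ C) (hut : u ≤ t) : u ≤ floorIn C t :=
  le_sSup ⟨hu, hut⟩

theorem ceilIn_le {u t : unitInterval} (hu : u ∈ C) (hut : t ≤ u) : ceilIn C t ≤ u :=
  sInf_le ⟨hu, hut⟩

end floor

variable {X : Type*}

/-- The set `C` of times is obtained by deleting intervals at the ends of which `f` takes the same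
value. -/
structure IsLoopErasure (f : unitInterval → X) (C : Set unitInterval) : Prop where
  isClosed : IsClosed C
  zero_mem : 0 ∈ C
  one_mem : 1 ∈ C
  eq_of_gap : ∀ s ∈ C, ∀ t ∈ C, s < t → Ioo s t ∩ C = ∅ → f s = f t

/-- The last time in `C` at which `f` is at a point that it has visited before `q`. -/
noncomputable def lastReturn (f : unitInterval → X) (C : Set unitInterval) (q : unitInterval) :
    unitInterval :=
  sSup {t | t ∈ C ∧ q ≤ t ∧ ∃ s ∈ C, s ≤ q ∧ f s = f t}

/-- The first visit of `f` to its position at the time `lastReturn f C q`. -/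
noncomputable def firstVisit (f : unitInterval → X) (C : Set unitInterval) (q : unitInterval) :
    unitInterval :=
  sInf {s | s ∈ C ∧ f s = f (lastReturn f C q)}

/-- Successive deletion of maximal loops around the points of a dense sequence. -/
noncomputable def erasure (f : unitInterval → X) : ℕ → Set unitInterval
  | 0 => univ
  | n + 1 => erasure f n \ Ioo (firstVisit f (erasure f n) (denseSeq unitInterval n))
      (lastReturn f (erasure f n) (denseSeq unitInterval n))

namespace IsLoopErasure

variable {f : unitInterval → X} {C : Set unitInterval}

theorem eq_floorIn_ceilIn (h : IsLoopErasure f C) (t : unitInterval) :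
    f (floorIn C t) = f (ceilIn C t) := by
  obtain ⟨hf, hft⟩ := floorIn_mem h.isClosed h.zero_mem t
  obtain ⟨hc, hct⟩ := ceilIn_mem h.isClosed h.one_mem t
  rcases (le_trans hft hct : floorIn C t ≤ ceilIn C t).eq_or_lt with e | hlt
  · rw [e]
  · refine h.eq_of_gap _ hf _ hc hlt (eq_empty_of_forall_notMem ?_)
    rintro u ⟨⟨h1, h2⟩, hu⟩
    rcases le_total u t with hut | hut
    · exact (le_floorIn hu hut).not_gt h1
    · exact (ceilIn_le hu hut).not_gt h2

theorem diff_Ioo (h : IsLoopErasure f C) {a b : unitInterval} (ha : a ∈ C) (hb : b ∈ C)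
    (hab : f a = f b) : IsLoopErasure f (C \ Ioo a b) := by
  refine ⟨?_, ⟨h.zero_mem, fun h' ↦ h'.1.not_ge unitInterval.nonneg'⟩,
    ⟨h.one_mem, fun h' ↦ h'.2.not_ge unitInterval.le_one'⟩, ?_⟩
  · rw [sdiff_eq]
    exact h.isClosed.inter isOpen_Ioo.isClosed_compl
  rintro s ⟨hs, hs'⟩ t ⟨ht, ht'⟩ hst hgap
  -- If the new gap contains an old point `u`, then `u` was deleted. Since `a` and `b` survive while
  -- `s` and `t` avoid `Ioo a b`, the gap is exactly `Ioo a b`.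
  by_cases hE : Ioo s t ∩ C = ∅
  · exact h.eq_of_gap s hs t ht hst hE
  obtain ⟨u, ⟨hsu, hut⟩, hu⟩ := nonempty_iff_ne_empty.2 hE
  have hgap' : ∀ v ∈ C, v ∉ Ioo a b → s < v → v < t → False := fun v h1 h2 h3 h4 ↦ by
    have : v ∈ Ioo s t ∩ (C \ Ioo a b) := ⟨⟨h3, h4⟩, h1, h2⟩
    rw [hgap] at this
    exact this
  obtain ⟨hau, hub⟩ : u ∈ Ioo a b := by_contra fun h' ↦ hgap' u hu h' hsu hut
  have has : a ≤ s := not_lt.1 fun h' ↦ hgap' a ha (by simp) h' (hau.trans hut)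
  have htb : t ≤ b := not_lt.1 fun h' ↦ hgap' b hb (by simp) (hsu.trans hub) h'
  have hsa : s ≤ a := not_lt.1 fun h' ↦ hs' ⟨h', hsu.trans hub⟩
  have hbt : b ≤ t := not_lt.1 fun h' ↦ ht' ⟨hau.trans hut, h'⟩
  rwa [le_antisymm hsa has, le_antisymm htb hbt]

variable [TopologicalSpace X] [T2Space X]

theorem isCompact_returns (hf : Continuous f) (h : IsClosed C) (q : unitInterval) :
    IsCompact {t | t ∈ C ∧ q ≤ t ∧ ∃ s ∈ C, s ≤ q ∧ f s = f t} := by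
  have : {t | t ∈ C ∧ q ≤ t ∧ ∃ s ∈ C, s ≤ q ∧ f s = f t} =
      C ∩ Ici q ∩ f ⁻¹' (f '' (C ∩ Iic q)) := by
    ext t
    simp only [mem_ofPred_eq, mem_inter_iff, mem_Ici, mem_preimage, mem_image, mem_Iic]
    constructor
    · rintro ⟨h1, h2, s, h3, h4, h5⟩
      exact ⟨⟨h1, h2⟩, s, ⟨h3, h4⟩, h5⟩
    · rintro ⟨⟨h1, h2⟩, s, ⟨h3, h4⟩, h5⟩
      exact ⟨h1, h2, s, h3, h4, h5⟩
  rw [this]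
  exact ((h.inter isClosed_Ici).inter
    (((h.inter isClosed_Iic).isCompact.image hf).isClosed.preimage hf)).isCompact

theorem lastReturn_mem (h : IsLoopErasure f C) (hf : Continuous f) (q : unitInterval) :
    lastReturn f C q ∈ {t | t ∈ C ∧ q ≤ t ∧ ∃ s ∈ C, s ≤ q ∧ f s = f t} := by
  -- Even if `q` itself has been deleted, the two ends of the gap around it carry the same value,
  -- which provides a return.
  refine (isCompact_returns hf h.isClosed q).sSup_mem ⟨ceilIn C q, ?_⟩
  obtain ⟨hf, hft⟩ := floorIn_mem h.isClosed h.zero_mem q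
  obtain ⟨hc, hct⟩ := ceilIn_mem h.isClosed h.one_mem q
  exact ⟨hc, hct, _, hf, hft, h.eq_floorIn_ceilIn q⟩

theorem firstVisit_mem (h : IsLoopErasure f C) (hf : Continuous f) (q : unitInterval) :
    firstVisit f C q ∈ {s | s ∈ C ∧ f s = f (lastReturn f C q)} := by
  refine IsCompact.sInf_mem ?_ ⟨_, (h.lastReturn_mem hf q).1, rfl⟩
  exact (h.isClosed.inter (isClosed_eq hf continuous_const)).isCompact

theorem firstVisit_le (h : IsLoopErasure f C) (hf : Continuous f) (q : unitInterval) :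
    firstVisit f C q ≤ q := by
  obtain ⟨-, -, s, hs, hsq, hst⟩ := h.lastReturn_mem hf q
  exact (sInf_le ⟨hs, hst⟩ : firstVisit f C q ≤ s).trans hsq

theorem erasure (hf : Continuous f) (n : ℕ) : IsLoopErasure f (erasure f n) := by
  induction n with
  | zero =>
    refine ⟨isClosed_univ, trivial, trivial, fun s _ t _ hst h ↦ ?_⟩
    rw [ArcLift.erasure, inter_univ] at h
    exact absurd h (nonempty_Ioo.2 hst).ne_empty
  | succ n ih =>
    exact ih.diff_Ioo (ih.firstVisit_mem hf _).1 (ih.lastReturn_mem hf _).1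
      (ih.firstVisit_mem hf _).2

end IsLoopErasure

theorem antitone_erasure (f : unitInterval → X) : Antitone (erasure f) :=
  antitone_nat_of_succ_le fun _ ↦ sdiff_subset

theorem tendsto_floorIn_erasure (f : unitInterval → X) (t : unitInterval) :
    Filter.Tendsto (fun n ↦ floorIn (erasure f n) t) Filter.atTop
      (𝓝 (⨅ n, floorIn (erasure f n) t)) :=
  tendsto_atTop_iInf fun _ _ h ↦ sSup_le_sSup (inter_subset_inter_left _ (antitone_erasure f h))

theorem tendsto_ceilIn_erasure (f : unitInterval → X) (t : unitInterval) :
    Filter.Tendsto (fun n ↦ ceilIn (erasure f n) t) Filter.atTop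
      (𝓝 (⨆ n, ceilIn (erasure f n) t)) :=
  tendsto_atTop_iSup fun _ _ h ↦ sInf_le_sInf (inter_subset_inter_left _ (antitone_erasure f h))

variable [TopologicalSpace X] [T2Space X] {f : unitInterval → X}

theorem mem_iInter_erasure_of_tendsto (hf : Continuous f) {u : ℕ → unitInterval} {x : unitInterval}
    (hu : ∀ n, u n ∈ erasure f n) (hx : Filter.Tendsto u Filter.atTop (𝓝 x)) :
    x ∈ ⋂ n, erasure f n := by
  refine mem_iInter.2 fun n ↦ (IsLoopErasure.erasure hf n).isClosed.mem_of_tendsto hx ?_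
  filter_upwards [Filter.eventually_ge_atTop n] with m hm
  exact antitone_erasure f hm (hu m)

/-- For `u` in a gap of the intersection, the ends of the stage-`n` gaps around `u` converge to
points of the intersection, necessarily the ends of the limit gap. Equality of the values passes to
the limit by continuity. -/
theorem IsLoopErasure.iInter_erasure (hf : Continuous f) :
    IsLoopErasure f (⋂ n, ArcLift.erasure f n) := by
  have hE := fun n ↦ IsLoopErasure.erasure hf n
  refine ⟨isClosed_iInter fun n ↦ (hE n).isClosed, mem_iInter.2 fun n ↦ (hE n).zero_mem,
    mem_iInter.2 fun n ↦ (hE n).one_mem, fun s hs t ht hst hgap ↦ ?_⟩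
  obtain ⟨u, hsu, hut⟩ := exists_between hst
  have hfl := fun n ↦ floorIn_mem (hE n).isClosed (hE n).zero_mem u
  have hcl := fun n ↦ ceilIn_mem (hE n).isClosed (hE n).one_mem u
  have h1 := tendsto_floorIn_erasure f u
  have h2 := tendsto_ceilIn_erasure f u
  set x := ⨅ n, floorIn (ArcLift.erasure f n) u
  set y := ⨆ n, ceilIn (ArcLift.erasure f n) u
  have hx : x ∈ ⋂ n, ArcLift.erasure f n :=
    mem_iInter_erasure_of_tendsto hf (fun n ↦ (hfl n).1) h1
  have hy : y ∈ ⋂ n, ArcLift.erasure f n :=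
    mem_iInter_erasure_of_tendsto hf (fun n ↦ (hcl n).1) h2
  have hxu : x ≤ u := le_of_tendsto' h1 fun n ↦ (hfl n).2
  have huy : u ≤ y := ge_of_tendsto' h2 fun n ↦ (hcl n).2
  have hsx : s ≤ x := ge_of_tendsto' h1 fun n ↦ le_floorIn (mem_iInter.1 hs n) hsu.le
  have hyt : y ≤ t := le_of_tendsto' h2 fun n ↦ ceilIn_le (mem_iInter.1 ht n) hut.le
  have hn : ∀ v ∈ ⋂ n, ArcLift.erasure f n, s < v → v < t → False := fun v h1 h2 h3 ↦ by
    have : v ∈ Ioo s t ∩ ⋂ n, ArcLift.erasure f n := ⟨⟨h2, h3⟩, h1⟩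
    rw [hgap] at this
    exact this
  have hsx' : x = s := le_antisymm (not_lt.1 fun h ↦ hn x hx h (hxu.trans_lt hut)) hsx
  have hyt' : y = t := le_antisymm hyt (not_lt.1 fun h ↦ hn y hy (hsu.trans_le huy) h)
  have h1' := (hf.tendsto x).comp h1
  have h2' := (hf.tendsto y).comp h2
  rw [hsx'] at h1'
  rw [hyt'] at h2'
  refine tendsto_nhds_unique h1' (h2'.congr fun n ↦ ?_)
  exact ((hE n).eq_floorIn_ceilIn u).symm

/-- At the stage of a dense point `q` in `Ioo s t`, maximality gives `t ≤ b`. As `t` survives the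
deletion of `Ioo a b`, in fact `b = t`; then `a ≤ s`, and everything between `s` and `t` has been
deleted. -/
theorem iInter_erasure_loop (hf : Continuous f) {s t : unitInterval}
    (hs : s ∈ ⋂ n, erasure f n) (ht : t ∈ ⋂ n, erasure f n) (hst : s < t) (h : f s = f t) :
    Ioo s t ∩ ⋂ n, erasure f n = ∅ := by
  obtain ⟨n, hsq, hqt⟩ := (denseRange_denseSeq unitInterval).exists_mem_open
    (isOpen_Ioo (a := s) (b := t)) (nonempty_Ioo.2 hst)
  set q := denseSeq unitInterval n with hq
  have hE := IsLoopErasure.erasure hf n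
  set a := firstVisit f (erasure f n) q with ha
  set b := lastReturn f (erasure f n) q with hb
  have hgap : ∀ v ∈ ⋂ n, erasure f n, v ∉ Ioo a b := fun v hv ↦ (mem_iInter.1 hv (n + 1)).2
  have hbm := hE.lastReturn_mem hf q
  have ham := hE.firstVisit_mem hf q
  rw [← hb] at hbm
  rw [← ha, ← hb] at ham
  have haq : a ≤ q := hE.firstVisit_le hf q
  have htb : t ≤ b :=
    le_sSup ⟨mem_iInter.1 ht n, hqt.le, s, mem_iInter.1 hs n, hsq.le, h⟩
  have hbt : b = t := le_antisymm (not_lt.1 fun h' ↦ hgap t ht ⟨haq.trans_lt hqt, h'⟩) htb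
  have has : a ≤ s := sInf_le ⟨mem_iInter.1 hs n, by rw [h, ← hbt]⟩
  refine eq_empty_of_forall_notMem ?_
  rintro v ⟨⟨hsv, hvt⟩, hv⟩
  exact hgap v hv ⟨has.trans_lt hsv, hbt ▸ hvt⟩

end ArcLift

namespace ArcLift

variable {X : Type*} [MetricSpace X] {f : unitInterval → X}

theorem IsLoopErasure.continuous_comp_floorIn {C : Set unitInterval} (h : IsLoopErasure f C)
    (hf : Continuous f) : Continuous fun t ↦ f (floorIn C t) := by
  -- Moving `floorIn C s` across its gap does not change the value of `f`. So either both times have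
  -- the same floor, or both values are taken by `f` inside `[s, t]`; the modulus of continuity of
  -- `f` is inherited.
  have key : ∀ s t : unitInterval, s ≤ t → f (floorIn C s) = f (floorIn C t) ∨
      ∃ s' t', s ≤ s' ∧ s' ≤ t' ∧ t' ≤ t ∧ f (floorIn C s) = f s' ∧ f (floorIn C t) = f t' := by
    intro s t hst
    obtain ⟨hc, hcs⟩ := ceilIn_mem h.isClosed h.one_mem s
    rcases le_or_gt (ceilIn C s) t with h1 | h1
    · exact Or.inr ⟨_, _, hcs, le_floorIn hc h1,
        (floorIn_mem h.isClosed h.zero_mem t).2, h.eq_floorIn_ceilIn s, rfl⟩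
    · left
      congr 1
      have hs := floorIn_mem h.isClosed h.zero_mem s
      have ht := floorIn_mem h.isClosed h.zero_mem t
      refine le_antisymm (le_floorIn hs.1 (le_trans hs.2 hst)) (le_floorIn ht.1 ?_)
      by_contra h2
      exact (ceilIn_le ht.1 (not_le.1 h2).le).not_gt (lt_of_le_of_lt ht.2 h1)
  have hu := CompactSpace.uniformContinuous_of_continuous hf
  refine UniformContinuous.continuous (Metric.uniformContinuous_iff.2 fun ε hε ↦ ?_)
  obtain ⟨δ, hδ, H⟩ := Metric.uniformContinuous_iff.1 hu ε hε
  have key' : ∀ s t : unitInterval, s ≤ t → dist s t < δ →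
      dist (f (floorIn C s)) (f (floorIn C t)) < ε := by
    intro s t hst hd
    rcases key s t hst with e | ⟨s', t', h1, h2, h3, e1, e2⟩
    · rw [e, dist_self]
      exact hε
    · rw [e1, e2]
      refine H (lt_of_le_of_lt ?_ hd)
      rw [Subtype.dist_eq, Subtype.dist_eq, Real.dist_eq, Real.dist_eq,
        abs_of_nonpos (sub_nonpos.2 (show (s' : ℝ) ≤ t' from h2)),
        abs_of_nonpos (sub_nonpos.2 (show (s : ℝ) ≤ t from hst))]
      have h1' : (s : ℝ) ≤ s' := h1
      have h3' : (t' : ℝ) ≤ t := h3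
      linarith
  refine ⟨δ, hδ, fun {s t} hd ↦ ?_⟩
  rcases le_total s t with hst | hst
  · exact key' s t hst hd
  · rw [dist_comm]
    exact key' t s hst (by rwa [dist_comm])

/-- The loop erasure of a path is a possibly degenerate arc with the same endpoints. -/
theorem isPDArc_image_iInter_erasure (hf : Continuous f) :
    IsPDArc (f '' ⋂ n, erasure f n) ∧ endpoints (f '' ⋂ n, erasure f n) = {f 0, f 1} := by
  have h := IsLoopErasure.iInter_erasure hf
  set C := ⋂ n, erasure f n with hC
  have hid : ∀ t ∈ C, floorIn C t = t := fun t ht ↦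
    le_antisymm (floorIn_mem h.isClosed h.zero_mem t).2 (le_floorIn ht le_rfl)
  have hr : range (fun t ↦ f (floorIn C t)) = f '' C := by
    ext z
    constructor
    · rintro ⟨t, rfl⟩
      exact mem_image_of_mem f (floorIn_mem h.isClosed h.zero_mem t).1
    · rintro ⟨t, ht, rfl⟩
      exact ⟨t, congrArg f (hid t ht)⟩
  have := isPDArc_range (h.continuous_comp_floorIn hf) (fun s u t hsu hut e ↦ ?_)
  · rwa [hr, hid 0 h.zero_mem, hid 1 h.one_mem] at this
  · obtain ⟨hs, hss⟩ := floorIn_mem h.isClosed h.zero_mem s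
    obtain ⟨hu, huu⟩ := floorIn_mem h.isClosed h.zero_mem u
    obtain ⟨ht, htt⟩ := floorIn_mem h.isClosed h.zero_mem t
    have h1 : floorIn C s ≤ floorIn C u := le_floorIn hs (le_trans hss hsu)
    have h2 : floorIn C u ≤ floorIn C t := le_floorIn hu (le_trans huu hut)
    -- Otherwise the floor of `u` would be a surviving time strictly inside a loop between surviving
    -- times, which `iInter_erasure_loop` excludes.
    rcases h1.eq_or_lt with e1 | l1
    · rw [e1]
    rcases h2.eq_or_lt with e2 | l2
    · rw [e2, e]
    have := iInter_erasure_loop hf hs ht (l1.trans l2) e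
    exact absurd this (nonempty_iff_ne_empty.1 ⟨_, ⟨l1, l2⟩, hu⟩)

/-- Loop erasure stays inside the range of the path, so from here on arcs can be replaced by paths.
-/
theorem arcJoinedIn_iff {A : Set X} {x y : X} : ArcJoinedIn A x y ↔ JoinedIn A x y := by
  refine ⟨ArcJoinedIn.joinedIn, fun ⟨γ, hγ⟩ ↦ ?_⟩
  have := isPDArc_image_iInter_erasure γ.continuous
  rw [γ.source, γ.target] at this
  refine ⟨_, ?_, this⟩
  rintro _ ⟨t, -, rfl⟩
  exact hγ t

end ArcLift

/-! ### Measurable dependence of the loop erasure on the path. -/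

namespace ArcLift

open MeasureTheory

/-- Merges an equation and an inequality into a single equation, so that order constraints on the
time can be absorbed into the test function. -/
theorem abs_add_max_eq_zero {x y : ℝ} : |x| + max 0 y = 0 ↔ y ≤ 0 ∧ x = 0 := by
  rw [add_eq_zero_iff_of_nonneg (abs_nonneg x) (le_max_left 0 y), abs_eq_zero, max_eq_left_iff,
    and_comm]

section Caratheodory

variable {P : Type*} [MeasurableSpace P]

/-- Measurability of a family of compact sets of times: the set of parameters for which a
Carathéodory function has a zero in the compact set is measurable. -/
def IsMeasurableFamily (C : P → Set unitInterval) : Prop :=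
  ∀ g : P → unitInterval → ℝ, (∀ t, Measurable fun p ↦ g p t) → (∀ p, Continuous (g p)) →
    MeasurableSet {p | ∃ t ∈ C p, g p t = 0}

/-- By compactness, a zero exists as soon as `|g p|` takes arbitrarily small values on a dense
sequence. -/
theorem isMeasurableFamily_univ : IsMeasurableFamily fun _ : P ↦ (univ : Set unitInterval) := by
  intro g hm hc
  have : {p | ∃ t ∈ (univ : Set unitInterval), g p t = 0} =
      ⋂ k : ℕ, ⋃ n : ℕ, {p | |g p (denseSeq unitInterval n)| < 1 / ((k : ℝ) + 1)} := by
    ext p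
    simp only [mem_ofPred_eq, mem_iInter, mem_iUnion, mem_univ, true_and]
    constructor
    · rintro ⟨t, ht⟩ k
      have hU : IsOpen {t | |g p t| < 1 / ((k : ℝ) + 1)} :=
        isOpen_lt (hc p).abs continuous_const
      exact (denseRange_denseSeq unitInterval).exists_mem_open hU
        ⟨t, by rw [mem_ofPred_eq, ht, abs_zero]; positivity⟩
    · intro H
      obtain ⟨t, -, ht⟩ := isCompact_univ.exists_isMinOn univ_nonempty (hc p).abs.continuousOn
      refine ⟨t, abs_eq_zero.1 (le_antisymm (le_of_forall_gt fun ε hε ↦ ?_) (abs_nonneg _))⟩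
      obtain ⟨k, hk⟩ := exists_nat_one_div_lt hε
      obtain ⟨n, hn⟩ := H k
      exact (ht (mem_univ (denseSeq unitInterval n))).trans_lt (hn.trans hk)
  rw [this]
  refine MeasurableSet.iInter fun k ↦ MeasurableSet.iUnion fun n ↦ ?_
  exact measurableSet_lt (hm _).abs measurable_const

variable {C : P → Set unitInterval}

theorem IsMeasurableFamily.inter_Iic (hC : IsMeasurableFamily C) {a : P → unitInterval}
    (ha : Measurable a) : IsMeasurableFamily fun p ↦ C p ∩ Iic (a p) := by
  intro g hm hc
  convert hC (fun p t ↦ |g p t| + max 0 ((t : ℝ) - a p)) (fun t ↦ ?_) (fun p ↦ ?_) using 1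
  · ext p
    simp only [mem_ofPred_eq, mem_inter_iff, and_assoc, mem_Iic, abs_add_max_eq_zero, sub_nonpos,
      Subtype.coe_le_coe]
  · have := hm t
    fun_prop
  · have := hc p
    fun_prop

theorem IsMeasurableFamily.inter_Ici (hC : IsMeasurableFamily C) {a : P → unitInterval}
    (ha : Measurable a) : IsMeasurableFamily fun p ↦ C p ∩ Ici (a p) := by
  intro g hm hc
  convert hC (fun p t ↦ |g p t| + max 0 ((a p : ℝ) - t)) (fun t ↦ ?_) (fun p ↦ ?_) using 1
  · ext p
    simp only [mem_ofPred_eq, mem_inter_iff, and_assoc, mem_Ici, abs_add_max_eq_zero, sub_nonpos,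
      Subtype.coe_le_coe]
  · have := hm t
    fun_prop
  · have := hc p
    fun_prop

theorem IsMeasurableFamily.diff_Ioo (hC : IsMeasurableFamily C) {a b : P → unitInterval}
    (ha : Measurable a) (hb : Measurable b) :
    IsMeasurableFamily fun p ↦ C p \ Ioo (a p) (b p) := by
  intro g hm hc
  convert (hC.inter_Iic ha g hm hc).union (hC.inter_Ici hb g hm hc) using 1
  ext p
  simp only [mem_ofPred_eq, mem_union, mem_inter_iff, mem_sdiff, mem_Ioo, mem_Iic, mem_Ici,
    not_and_or, not_lt, ← exists_or]
  refine exists_congr fun t ↦ ?_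
  tauto

variable {X : Type*} [MetricSpace X] [MeasurableSpace X] [BorelSpace X]
  {f : P → unitInterval → X}

theorem measurable_comp_of_continuous (hm : ∀ t, Measurable fun p ↦ f p t)
    (hc : ∀ p, Continuous (f p)) {b : P → unitInterval} (hb : Measurable b) :
    Measurable fun p ↦ f p (b p) :=
  (measurable_uncurry_of_continuous_of_measurable (u := fun t p ↦ f p t) hc hm).comp
    (hb.prodMk measurable_id)

variable [SecondCountableTopology X]

/-- The last return is at least `c` exactly when some `t ≥ max c q` in `C` has `f t` in the compact
set `f '' (C ∩ Iic q)`. This is the vanishing of a distance, whose measurability in `p` is again a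
zero problem, now for `C ∩ Iic q`. -/
theorem measurable_lastReturn (hm : ∀ t, Measurable fun p ↦ f p t) (hc : ∀ p, Continuous (f p))
    (hC : IsMeasurableFamily C) (hE : ∀ p, IsLoopErasure (f p) (C p)) (q : unitInterval) :
    Measurable fun p ↦ lastReturn (f p) (C p) q := by
  refine measurable_of_Ici fun c ↦ ?_
  have hne : ∀ p, (f p '' (C p ∩ Iic q)).Nonempty := fun p ↦
    ⟨f p 0, 0, ⟨(hE p).zero_mem, unitInterval.nonneg'⟩, rfl⟩
  have hcp : ∀ p, IsCompact (f p '' (C p ∩ Iic q)) := fun p ↦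
    ((hE p).isClosed.inter isClosed_Iic).isCompact.image (hc p)
  have hset : (fun p ↦ lastReturn (f p) (C p) q) ⁻¹' Ici c =
      {p | ∃ t ∈ C p ∩ Ici (max c q), Metric.infDist (f p t) (f p '' (C p ∩ Iic q)) = 0} := by
    ext p
    have hmem := (hE p).lastReturn_mem (hc p) q
    have hiff : ∀ t, Metric.infDist (f p t) (f p '' (C p ∩ Iic q)) = 0 ↔
        ∃ s ∈ C p, s ≤ q ∧ f p s = f p t := fun t ↦ by
      rw [← (hcp p).isClosed.mem_iff_infDist_zero (hne p)]
      simp only [mem_image, mem_inter_iff, mem_Iic, and_assoc]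
    simp only [mem_preimage, mem_Ici, mem_ofPred_eq, hiff, mem_inter_iff, max_le_iff]
    constructor
    · intro h
      exact ⟨_, ⟨hmem.1, h, hmem.2.1⟩, hmem.2.2⟩
    · rintro ⟨t, ⟨h1, h2, h3⟩, h4⟩
      exact h2.trans (le_sSup ⟨h1, h3, h4⟩)
  rw [hset]
  refine hC.inter_Ici measurable_const _ (fun t ↦ measurable_of_Iic fun r ↦ ?_) fun p ↦ ?_
  · have : (fun p ↦ Metric.infDist (f p t) (f p '' (C p ∩ Iic q))) ⁻¹' Iic r =
        {p | ∃ s ∈ C p ∩ Iic q, max 0 (dist (f p t) (f p s) - r) = 0} := by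
      ext p
      simp only [mem_preimage, mem_Iic, mem_ofPred_eq, max_eq_left_iff, sub_nonpos]
      constructor
      · intro h
        obtain ⟨_, ⟨s, hs, rfl⟩, e⟩ := (hcp p).exists_infDist_eq_dist (hne p) (f p t)
        exact ⟨s, hs, e ▸ h⟩
      · rintro ⟨s, hs, h⟩
        exact (Metric.infDist_le_dist_of_mem (mem_image_of_mem _ hs)).trans h
    rw [this]
    refine hC.inter_Iic measurable_const _ (fun s ↦ ?_) fun p ↦ ?_
    · have h1 := hm t
      have h2 := hm s
      fun_prop
    · have := hc p
      fun_prop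
  · exact (Metric.continuous_infDist_pt _).comp (hc p)

theorem measurable_firstVisit (hm : ∀ t, Measurable fun p ↦ f p t) (hc : ∀ p, Continuous (f p))
    (hC : IsMeasurableFamily C) (hE : ∀ p, IsLoopErasure (f p) (C p)) (q : unitInterval) :
    Measurable fun p ↦ firstVisit (f p) (C p) q := by
  refine measurable_of_Iic fun c ↦ ?_
  have hset : (fun p ↦ firstVisit (f p) (C p) q) ⁻¹' Iic c =
      {p | ∃ s ∈ C p ∩ Iic c, dist (f p s) (f p (lastReturn (f p) (C p) q)) = 0} := by
    ext p
    have hmem := (hE p).firstVisit_mem (hc p) q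
    simp only [mem_preimage, mem_Iic, mem_ofPred_eq, dist_eq_zero, mem_inter_iff]
    constructor
    · intro h
      exact ⟨_, ⟨hmem.1, h⟩, hmem.2⟩
    · rintro ⟨s, ⟨h1, h2⟩, h3⟩
      exact (sInf_le ⟨h1, h3⟩ : firstVisit (f p) (C p) q ≤ s).trans h2
  rw [hset]
  have hb := measurable_comp_of_continuous hm hc (measurable_lastReturn hm hc hC hE q)
  refine hC.inter_Iic measurable_const _ (fun s ↦ (hm s).dist hb) fun p ↦ ?_
  have := hc p
  fun_prop

theorem isMeasurableFamily_erasure (hm : ∀ t, Measurable fun p ↦ f p t)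
    (hc : ∀ p, Continuous (f p)) (n : ℕ) : IsMeasurableFamily fun p ↦ erasure (f p) n := by
  induction n with
  | zero => exact isMeasurableFamily_univ
  | succ n ih =>
    have hE := fun p ↦ IsLoopErasure.erasure (hc p) n
    exact ih.diff_Ioo (measurable_firstVisit hm hc ih hE _) (measurable_lastReturn hm hc ih hE _)

theorem measurableSet_image_iInter_erasure_inter (hm : ∀ t, Measurable fun p ↦ f p t)
    (hc : ∀ p, Continuous (f p)) {F : Set X} (hF : IsClosed F) :
    MeasurableSet {p | ((f p '' ⋂ n, erasure (f p) n) ∩ F).Nonempty} := by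
  rcases F.eq_empty_or_nonempty with rfl | hne
  · simp
  have : {p | ((f p '' ⋂ n, erasure (f p) n) ∩ F).Nonempty} =
      ⋂ n, {p | ∃ t ∈ erasure (f p) n, Metric.infDist (f p t) F = 0} := by
    ext p
    simp only [mem_ofPred_eq, mem_iInter, ← hF.mem_iff_infDist_zero hne]
    constructor
    · rintro ⟨_, ⟨t, ht, rfl⟩, htF⟩ n
      exact ⟨t, mem_iInter.1 ht n, htF⟩
    · intro H
      -- The finite stages give decreasing nonempty compact sets of times, whose intersection is
      -- nonempty.
      have hcl : ∀ n, IsClosed (erasure (f p) n ∩ f p ⁻¹' F) := fun n ↦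
        (IsLoopErasure.erasure (hc p) n).isClosed.inter (hF.preimage (hc p))
      obtain ⟨t, ht⟩ := IsCompact.nonempty_iInter_of_sequence_nonempty_isCompact_isClosed
        (fun n ↦ erasure (f p) n ∩ f p ⁻¹' F)
        (fun n ↦ inter_subset_inter_left _ (antitone_erasure _ n.le_succ)) H
        (hcl 0).isCompact hcl
      rw [mem_iInter] at ht
      exact ⟨f p t, mem_image_of_mem _ (mem_iInter.2 fun n ↦ (ht n).1), (ht 0).2⟩
  rw [this]
  refine MeasurableSet.iInter fun n ↦ isMeasurableFamily_erasure hm hc n _ (fun t ↦ ?_) fun p ↦ ?_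
  · exact (hm t).infDist
  · exact (Metric.continuous_infDist_pt _).comp (hc p)

end Caratheodory

/-- Second countability reduces the Borel sets to a subbasis: being contained in `U` is missing a
closed set, and meeting an open set is meeting one of countably many closed sets that exhaust it. -/
theorem measurable_nonemptyCompacts {P X : Type*} [MeasurableSpace P] [MetricSpace X]
    [SecondCountableTopology X] {ψ : P → NonemptyCompacts X}
    (h : ∀ F : Set X, IsClosed F → MeasurableSet {p | ((ψ p : Set X) ∩ F).Nonempty}) :
    @Measurable P (NonemptyCompacts X) _ (borel _) ψ := by
  have htop : (inferInstance : TopologicalSpace (NonemptyCompacts X)) =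
      generateFrom (preimage ((↑) : NonemptyCompacts X → Set X) ''
        (powerset '' {U | IsOpen U} ∪
          (fun V : Set X ↦ {s | (s ∩ V).Nonempty}) '' {V | IsOpen V})) := induced_generateFrom_eq
  rw [borel_eq_generateFrom_of_subbasis htop]
  refine measurable_generateFrom ?_
  rintro _ ⟨_, (⟨U, hU, rfl⟩ | ⟨U, hU, rfl⟩), rfl⟩
  · convert (h Uᶜ (isClosed_compl_iff.2 hU)).compl using 1
    ext p
    simp [not_nonempty_iff_eq_empty, ← subset_compl_iff_disjoint_right, ← disjoint_iff_inter_eq_empty]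
  · obtain ⟨F, hF, -, hFU, -⟩ := IsOpen.exists_iUnion_isClosed hU
    convert MeasurableSet.iUnion fun n ↦ h (F n) (hF n) using 1
    ext p
    simp only [mem_preimage, mem_ofPred_eq, mem_iUnion, ← hFU, inter_iUnion, nonempty_iUnion]

end ArcLift

/-! ### From measurable paths to a Borel arc-lifting. -/

namespace ArcLift

open MeasureTheory

theorem hasBorelArcLifting_of_paths {X : Type*} [MetricSpace X] [SecondCountableTopology X]
    {S : Set X} (c : S → unitInterval → X) (hm : ∀ t, IsBorelMap fun x ↦ c x t)
    (hc : ∀ x, Continuous (c x)) (h1 : ∀ x, c x 1 = x)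
    (h0 : ∀ x y : S, ((x : X), (y : X)) ∈ arcRel X → c x 0 = c y 0) :
    HasBorelArcLifting X S := by
  borelize X
  let _ : MeasurableSpace S := borel S
  have _ : BorelSpace S := ⟨rfl⟩
  let _ : MeasurableSpace ↥((S ×ˢ S) ∩ arcRel X) := borel _
  have _ : BorelSpace ↥((S ×ˢ S) ∩ arcRel X) := ⟨rfl⟩
  have hm' : ∀ t, Measurable fun x ↦ c x t := fun t ↦ by
    have := hm t
    rwa [IsBorelMap, ← BorelSpace.measurable_eq (α := X)] at this
  let fst : ↥((S ×ˢ S) ∩ arcRel X) → S := fun p ↦ ⟨p.1.1, p.2.1.1⟩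
  let snd : ↥((S ×ˢ S) ∩ arcRel X) → S := fun p ↦ ⟨p.1.2, p.2.1.2⟩
  have hfst : Measurable fst := Continuous.measurable (by fun_prop)
  have hsnd : Measurable snd := Continuous.measurable (by fun_prop)
  let γ : ∀ x : S, Path (c x 0) (x : X) := fun x ↦ ⟨⟨c x, hc x⟩, rfl, h1 x⟩
  -- Back from the first point to the common base point, then out to the second; at each fixed time
  -- only one of the two paths is involved, whence measurability.
  let Γ : ∀ p : ↥((S ×ˢ S) ∩ arcRel X), Path (fst p : X) (snd p : X) := fun p ↦
    (γ (fst p)).symm.trans ((γ (snd p)).cast (h0 _ _ p.2.2) rfl)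
  let f : ↥((S ×ˢ S) ∩ arcRel X) → unitInterval → X := fun p t ↦ Γ p t
  have hfc : ∀ p, Continuous (f p) := fun p ↦ (Γ p).continuous
  have hfm : ∀ t, Measurable fun p ↦ f p t := fun t ↦ by
    by_cases ht : (t : ℝ) ≤ 1 / 2
    · simp only [f, Γ, Path.trans_apply, dif_pos ht]
      exact (hm' _).comp hfst
    · simp only [f, Γ, Path.trans_apply, dif_neg ht]
      exact (hm' _).comp hsnd
  have hE := fun p ↦ IsLoopErasure.iInter_erasure (hfc p)
  refine ⟨fun p ↦ ⟨⟨f p '' ⋂ n, erasure (f p) n, (hE p).isClosed.isCompact.image (hfc p)⟩,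
    ⟨f p 0, 0, (hE p).zero_mem, rfl⟩⟩, fun p ↦ ?_, ?_⟩
  · have := isPDArc_image_iInter_erasure (hfc p)
    have e0 : f p 0 = p.1.1 := (Γ p).source
    have e1 : f p 1 = p.1.2 := (Γ p).target
    rwa [e0, e1] at this
  · exact measurable_nonemptyCompacts fun F hF ↦ measurableSet_image_iInter_erasure_inter hfm hfc hF

/-! ### Infinite concatenation of paths. -/

section concat

variable {X : Type*}

/-- The concatenation of the first `n + 1` paths of a sequence, parametrized by the real line. -/
noncomputable def concatUpTo (a : ℕ → unitInterval → X) : ℕ → ℝ → X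
  | 0, u => a 0 (projIcc 0 1 zero_le_one u)
  | n + 1, u => if (n + 1 : ℝ) ≤ u then a (n + 1) (projIcc 0 1 zero_le_one (u - (n + 1)))
      else concatUpTo a n u

theorem concatUpTo_floor (a : ℕ → unitInterval → X) {u : ℝ} (hu : 0 ≤ u) :
    concatUpTo a ⌊u⌋₊ u = a ⌊u⌋₊ (projIcc 0 1 zero_le_one (u - ⌊u⌋₊)) := by
  have h := Nat.floor_le hu
  rcases e : ⌊u⌋₊ with - | n
  · simp [concatUpTo]
  · rw [e] at h
    push_cast at h ⊢
    rw [concatUpTo, if_pos h]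

theorem concatUpTo_succ (a : ℕ → unitInterval → X) {n : ℕ} {u : ℝ} (hu : u < n + 1) :
    concatUpTo a (n + 1) u = concatUpTo a n u := by
  rw [concatUpTo, if_neg (not_le.2 hu)]

theorem concatUpTo_of_le (a : ℕ → unitInterval → X) {n m : ℕ} (hnm : n ≤ m) {u : ℝ}
    (hu : u < n + 1) : concatUpTo a m u = concatUpTo a n u := by
  induction m, hnm using Nat.le_induction with
  | base => rfl
  | succ m hm ih =>
    rw [concatUpTo_succ, ih]
    have : (n : ℝ) ≤ m := by exact_mod_cast hm
    linarith

/-- The concatenation of a sequence of paths, completed by its limit `x`. -/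
noncomputable def concat (a : ℕ → unitInterval → X) (x : X) (t : unitInterval) : X :=
  -- The change of time `t / (1 - t)` maps `[0, 1)` onto `[0, ∞)`, where the `n`-th path occupies
  -- `[n, n + 1]`.
  if t = 1 then x else concatUpTo a ⌊(t : ℝ) / (1 - t)⌋₊ ((t : ℝ) / (1 - t))

theorem concat_one (a : ℕ → unitInterval → X) (x : X) : concat a x 1 = x := if_pos rfl

theorem concat_zero (a : ℕ → unitInterval → X) (x : X) : concat a x 0 = a 0 0 := by
  simp [concat, concatUpTo]

theorem concat_mem {a : ℕ → unitInterval → X} {x : X} {N : Set X} (hx : x ∈ N)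
    (ha : ∀ n t, a n t ∈ N) (t : unitInterval) : concat a x t ∈ N := by
  unfold concat
  split_ifs with h
  · exact hx
  · rw [concatUpTo_floor a (div_nonneg t.2.1 (sub_nonneg.2 t.2.2))]
    exact ha _ _

theorem continuous_concatUpTo [TopologicalSpace X] {a : ℕ → unitInterval → X}
    (hc : ∀ n, Continuous (a n)) (h : ∀ n, a n 1 = a (n + 1) 0) (n : ℕ) :
    Continuous (concatUpTo a n) := by
  induction n with
  | zero => exact (hc 0).comp continuous_projIcc
  | succ n ih =>
    have h1 : Continuous fun u : ℝ ↦ a (n + 1) (projIcc 0 1 zero_le_one (u - (n + 1))) :=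
      (hc _).comp (continuous_projIcc.comp (by fun_prop))
    refine Continuous.if_le h1 ih continuous_const continuous_id ?_
    rintro u rfl
    have e0 : projIcc (0 : ℝ) 1 zero_le_one (((n : ℝ) + 1) - (n + 1)) = 0 := by
      rw [sub_self]; exact projIcc_of_le_left _ le_rfl
    change a (n + 1) _ = concatUpTo a n ((n : ℝ) + 1)
    rw [e0, ← h n]
    rcases n with - | n
    · simp only [concatUpTo, Nat.cast_zero, zero_add]
      rw [projIcc_of_right_le _ le_rfl]; rfl
    · push_cast
      rw [concatUpTo, if_pos (by linarith)]
      have : (n : ℝ) + 1 + 1 - (n + 1) = 1 := by ring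
      rw [this, projIcc_of_right_le _ le_rfl]; rfl

theorem continuous_concat [PseudoMetricSpace X] {a : ℕ → unitInterval → X} {x : X}
    (hc : ∀ n, Continuous (a n)) (h : ∀ n, a n 1 = a (n + 1) 0)
    (hx : ∀ ε > 0, ∃ N, ∀ n ≥ N, ∀ t, dist (a n t) x < ε) : Continuous (concat a x) := by
  rw [continuous_iff_continuousAt]
  intro t
  by_cases ht : t = 1
  · subst ht
    rw [Metric.continuousAt_iff']
    intro ε hε
    obtain ⟨N, hN⟩ := hx ε hε
    -- This says `N < s / (1 - s)` for `s < 1`: near time `1` only paths of index at least `N` are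
    -- running.
    have hev : ∀ᶠ s : unitInterval in 𝓝 1, (N : ℝ) * (1 - s) < s :=
      ContinuousAt.eventually_lt (by fun_prop) (by fun_prop) (by simp)
    filter_upwards [hev] with s hs
    rw [concat_one]
    unfold concat
    split_ifs with h1
    · rwa [dist_self]
    · have hs1 : (0 : ℝ) < 1 - s := sub_pos.2 (lt_of_le_of_ne s.2.2 fun e ↦ h1 (Subtype.ext e))
      rw [concatUpTo_floor a (div_nonneg s.2.1 hs1.le)]
      exact hN _ (Nat.le_floor ((le_div_iff₀ hs1).2 hs.le)) _
  · have ht1 : (0 : ℝ) < 1 - t := sub_pos.2 (lt_of_le_of_ne t.2.2 fun e ↦ ht (Subtype.ext e))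
    have hu : ContinuousAt (fun s : unitInterval ↦ (s : ℝ) / (1 - s)) t :=
      ContinuousAt.div (by fun_prop) (by fun_prop) ht1.ne'
    have hlt : (t : ℝ) / (1 - t) < ⌊(t : ℝ) / (1 - t)⌋₊ + 1 := Nat.lt_floor_add_one _
    set m := ⌊(t : ℝ) / (1 - t)⌋₊ with hm
    have hc' : ContinuousAt (fun s : unitInterval ↦ concatUpTo a m ((s : ℝ) / (1 - s))) t :=
      ((continuous_concatUpTo hc h m).continuousAt).comp hu
    refine hc'.congr ?_
    filter_upwards [hu.eventually_lt continuousAt_const hlt, isOpen_ne.mem_nhds ht] with s hs hs1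
    rw [concat, if_neg hs1]
    have hs0 : (0 : ℝ) ≤ (s : ℝ) / (1 - s) := div_nonneg s.2.1 (sub_nonneg.2 s.2.2)
    refine concatUpTo_of_le a ?_ (Nat.lt_floor_add_one _)
    have : ⌊(s : ℝ) / (1 - s)⌋₊ < m + 1 := (Nat.floor_lt hs0).2 (by exact_mod_cast hs)
    omega

theorem measurable_concat {P : Type*} [MeasurableSpace P] [MeasurableSpace X]
    {a : P → ℕ → unitInterval → X} {x : P → X} (hx : Measurable x)
    (ha : ∀ n t, Measurable fun p ↦ a p n t) (t : unitInterval) :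
    Measurable fun p ↦ concat (a p) (x p) t := by
  by_cases ht : t = 1
  · simpa only [concat, if_pos ht] using hx
  · have h0 : (0 : ℝ) ≤ (t : ℝ) / (1 - t) := div_nonneg t.2.1 (sub_nonneg.2 t.2.2)
    simp only [concat, if_neg ht, concatUpTo_floor _ h0]
    exact ha _ _

end concat

end ArcLift

/-! ### The arc-metric in terms of paths, and the measurable choice of paths. -/

namespace ArcLift

open MeasureTheory

section arcEDist

variable {X : Type*} [MetricSpace X]

theorem isArcConnected_range_path {x y : X} (γ : Path x y) : IsArcConnected (range γ) := by
  have : PathConnectedSpace unitInterval := isPathConnected_iff_pathConnectedSpace.1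
    ((convex_Icc (0 : ℝ) 1).isPathConnected ⟨0, by simp⟩)
  intro a ha b hb
  rw [arcJoinedIn_iff]
  exact (isPathConnected_range γ.continuous).joinedIn a ha b hb

theorem arcEDist_lt_iff {x y : X} {r : ℝ≥0∞} :
    arcEDist x y < r ↔ ∃ γ : Path x y, Metric.ediam (range γ) < r := by
  simp only [arcEDist, iInf_lt_iff]
  constructor
  · rintro ⟨H, ⟨hH, hxy⟩, hd⟩
    obtain ⟨γ, hγ⟩ := arcJoinedIn_iff.1 (hH x (hxy (by simp)) y (hxy (by simp)))
    exact ⟨γ, (Metric.ediam_mono (range_subset_iff.2 hγ)).trans_lt hd⟩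
  · rintro ⟨γ, hd⟩
    refine ⟨range γ, ⟨isArcConnected_range_path γ, ?_⟩, hd⟩
    rintro _ (rfl | rfl)
    · exact ⟨0, γ.source⟩
    · exact ⟨1, γ.target⟩

theorem arcEDist_eq_iInf (x y : X) :
    arcEDist x y = ⨅ γ : Path x y, Metric.ediam (range γ) :=
  eq_of_forall_gt_iff fun r ↦ by rw [arcEDist_lt_iff, iInf_lt_iff]

theorem edist_le_arcEDist (x y : X) : edist x y ≤ arcEDist x y := by
  simp only [arcEDist, le_iInf_iff]
  exact fun H ⟨_, hxy⟩ ↦ Metric.edist_le_ediam_of_mem (hxy (by simp)) (hxy (by simp))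

theorem arcEDist_comm (x y : X) : arcEDist x y = arcEDist y x := by
  simp only [arcEDist, pair_comm]

theorem arcEDist_self (x : X) : arcEDist x x = 0 := by
  refine le_antisymm (le_of_forall_gt fun r hr ↦ ?_) zero_le
  exact arcEDist_lt_iff.2 ⟨Path.refl x, by simpa using hr⟩

theorem arcEDist_triangle (x y z : X) : arcEDist x z ≤ arcEDist x y + arcEDist y z := by
  simp only [arcEDist_eq_iInf, ENNReal.iInf_add, ENNReal.add_iInf]
  refine le_iInf fun γ' ↦ le_iInf fun γ ↦ iInf_le_of_le (γ.trans γ') ?_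
  rw [Path.trans_range]
  exact Metric.ediam_union_le ⟨y, ⟨1, γ.target⟩, 0, γ'.source⟩

theorem joined_of_arcEDist_lt {x y : X} {r : ℝ≥0∞} (h : arcEDist x y < r) : Joined x y :=
  let ⟨γ, _⟩ := arcEDist_lt_iff.1 h
  ⟨γ⟩

end arcEDist

variable {M : Type*} [MetricSpace M]

/-- A path from `x` to `y` of diameter less than `r`, if there is one. -/
noncomputable def shortPath (r : ℝ≥0∞) (x y : M) (t : unitInterval) : M :=
  open Classical in
  if h : arcEDist x y < r then (arcEDist_lt_iff.1 h).choose t else x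

theorem continuous_shortPath (r : ℝ≥0∞) (x y : M) : Continuous (shortPath r x y) := by
  unfold shortPath
  split_ifs with h
  · exact (arcEDist_lt_iff.1 h).choose.continuous
  · exact continuous_const

theorem shortPath_zero (r : ℝ≥0∞) (x y : M) : shortPath r x y 0 = x := by
  unfold shortPath
  split_ifs with h
  · exact (arcEDist_lt_iff.1 h).choose.source
  · rfl

theorem shortPath_one {r : ℝ≥0∞} {x y : M} (h : arcEDist x y < r) : shortPath r x y 1 = y := by
  rw [shortPath, dif_pos h]
  exact (arcEDist_lt_iff.1 h).choose.target

theorem edist_shortPath_lt {r : ℝ≥0∞} {x y : M} (h : arcEDist x y < r) (t : unitInterval) :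
    edist (shortPath r x y t) x < r := by
  rw [shortPath, dif_pos h]
  have hγ := (arcEDist_lt_iff.1 h).choose_spec
  refine (Metric.edist_le_ediam_of_mem (mem_range_self t) ⟨0, Path.source _⟩).trans_lt hγ

/-- A point chosen in each path component. -/
noncomputable def basePoint (x : M) : M := Quotient.out (⟦x⟧ : ZerothHomotopy M)

theorem joined_basePoint (x : M) : Joined (basePoint x) x :=
  Quotient.exact (s := pathSetoid M) (Quotient.out_eq (⟦x⟧ : ZerothHomotopy M))

theorem basePoint_eq {x y : M} (h : Joined x y) : basePoint x = basePoint y :=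
  congrArg Quotient.out (Quotient.sound h : (⟦x⟧ : ZerothHomotopy M) = ⟦y⟧)

/-- The paths from a base point and through approximations by points of the sequence `D`, given by
the choice `k` of indices. -/
noncomputable def approxPath (D : ℕ → M) (k : ℕ → ℕ) : ℕ → unitInterval → M
  | 0 => (joined_basePoint (D (k 0))).somePath
  | n + 1 => shortPath (2 * (n + 1 : ℝ≥0∞)⁻¹) (D (k n)) (D (k (n + 1)))

/-- The short paths are chosen arbitrarily, but only for countably many pairs of indices, so the
choice needs no measurability. -/
theorem measurable_of_indices {S Y : Type*} [MeasurableSpace S] [MeasurableSpace Y]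
    (g : ℕ → ℕ → Y) {k l : S → ℕ} (hk : Measurable k) (hl : Measurable l) :
    Measurable fun x ↦ g (k x) (l x) :=
  (measurable_of_countable (Function.uncurry g)).comp (hk.prodMk hl)

/-- Each `x` is reached through its approximations `D (k x n)`, where `k x n` is the least
admissible index and hence measurable in `x`. The set `N` consists of `S` and the countably many
connecting paths. -/
theorem exists_measurable_paths {S : Set M} (D : ℕ → M)
    (hD : ∀ x ∈ S, ∀ r > 0, ∃ n, arcEDist x (D n) < r)
    (hmeas : ∀ n r, @MeasurableSet S (borel S) {x | arcEDist (x : M) (D n) < r}) :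
    ∃ (N : Set M) (c : S → unitInterval → M), S ⊆ N ∧ IsSeparable N ∧
      (∀ t, IsBorelMap fun x ↦ c x t) ∧ (∀ x, Continuous (c x)) ∧ (∀ x, c x 1 = x) ∧
      (∀ x t, c x t ∈ N) ∧ ∀ x y : S, Joined (x : M) y → c x 0 = c y 0 := by
  classical
  let _ : MeasurableSpace S := borel S
  have _ : BorelSpace S := ⟨rfl⟩
  have hε : ∀ n : ℕ, (0 : ℝ≥0∞) < (n + 1 : ℝ≥0∞)⁻¹ := fun n ↦ by
    rw [ENNReal.inv_pos]
    exact_mod_cast ENNReal.natCast_ne_top (n + 1)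
  have hex : ∀ (n : ℕ) (x : S), ∃ i, arcEDist (x : M) (D i) < (n + 1 : ℝ≥0∞)⁻¹ :=
    fun n x ↦ hD x x.2 _ (hε n)
  obtain ⟨k, hk, hkm⟩ : ∃ k : S → ℕ → ℕ,
      (∀ (x : S) n, arcEDist (x : M) (D (k x n)) < (n + 1 : ℝ≥0∞)⁻¹) ∧
      ∀ n, Measurable fun x ↦ k x n :=
    ⟨fun x n ↦ Nat.find (hex n x), fun x n ↦ Nat.find_spec (hex n x),
      fun n ↦ measurable_find (hex n) fun i ↦ hmeas i _⟩
  -- The triangle inequality through `x` gives `1 / (n + 1) + 1 / (n + 2)`; this is the source of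
  -- the factor `2` in `approxPath`.
  have hkk : ∀ (x : S) n, arcEDist (D (k x n)) (D (k x (n + 1))) < 2 * (n + 1 : ℝ≥0∞)⁻¹ := by
    intro x n
    refine (arcEDist_triangle _ (x : M) _).trans_lt ?_
    rw [two_mul, arcEDist_comm _ (x : M)]
    refine ENNReal.add_lt_add (hk x n) ((hk x (n + 1)).trans_le ?_)
    rw [ENNReal.inv_le_inv]
    exact_mod_cast (n + 1).le_succ
  let a : S → ℕ → unitInterval → M := fun x ↦ approxPath D (k x)
  have hac : ∀ x n, Continuous (a x n) := by
    rintro x (- | n)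
    · exact (joined_basePoint (D (k x 0))).somePath.continuous
    · exact continuous_shortPath _ _ _
  have haa : ∀ x n, a x n 1 = a x (n + 1) 0 := by
    intro x n
    have h0 : a x (n + 1) 0 = D (k x n) := shortPath_zero _ _ _
    rw [h0]
    rcases n with - | n
    · exact (joined_basePoint (D (k x 0))).somePath.target
    · exact shortPath_one (hkk x n)
  have hlim : ∀ x : S, ∀ ε > 0, ∃ N, ∀ n ≥ N, ∀ t, dist (a x n t) (x : M) < ε := by
    intro x ε hε
    -- Of the factor `3`, two parts bound the distance to the start of the short path and one the
    -- distance from there to `x`.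
    have ht : Filter.Tendsto (fun n : ℕ ↦ 3 * (n + 1 : ℝ≥0∞)⁻¹) Filter.atTop (𝓝 0) := by
      have := ENNReal.Tendsto.const_mul (a := 3)
        ((Filter.tendsto_add_atTop_iff_nat 1).2 ENNReal.tendsto_inv_nat_nhds_zero)
        (Or.inr (by simp))
      simpa using this
    obtain ⟨N, hN⟩ := Filter.eventually_atTop.1
      (ht.eventually (gt_mem_nhds (ENNReal.ofReal_pos.2 hε)))
    refine ⟨N + 1, fun n hn t ↦ ?_⟩
    obtain ⟨n, rfl⟩ : ∃ m, n = m + 1 := ⟨n - 1, by omega⟩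
    rw [← ENNReal.ofReal_lt_ofReal_iff hε, ← edist_dist]
    refine lt_trans ?_ (hN n (by omega))
    calc edist (a x (n + 1) t) x ≤ edist (a x (n + 1) t) (D (k x n)) + edist (D (k x n)) x :=
          edist_triangle _ _ _
      _ < 2 * (n + 1 : ℝ≥0∞)⁻¹ + (n + 1 : ℝ≥0∞)⁻¹ := by
          refine ENNReal.add_lt_add (edist_shortPath_lt (hkk x n) t) ?_
          rw [edist_comm]
          exact (edist_le_arcEDist _ _).trans_lt (hk x n)
      _ = 3 * (n + 1 : ℝ≥0∞)⁻¹ := by ring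
  have hmeas_a : ∀ n t, @Measurable S M _ (borel M) fun x ↦ a x n t := by
    let _ : MeasurableSpace M := borel M
    rintro (- | n) t
    · exact (measurable_from_nat
        (f := fun i ↦ (joined_basePoint (D i)).somePath t)).comp (hkm 0)
    · exact measurable_of_indices (fun i j ↦ shortPath (2 * (n + 1 : ℝ≥0∞)⁻¹) (D i) (D j) t)
        (hkm n) (hkm (n + 1))
  refine ⟨S ∪ ((⋃ i, range (joined_basePoint (D i)).somePath) ∪
    ⋃ (n : ℕ) (i : ℕ) (j : ℕ), range (shortPath (2 * (n + 1 : ℝ≥0∞)⁻¹) (D i) (D j))),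
    fun x ↦ concat (a x) x, subset_union_left, ?_, fun t ↦ ?_, fun x ↦ ?_, fun x ↦ concat_one _ _,
    fun x t ↦ ?_, fun x y hxy ↦ ?_⟩
  · have hS : IsSeparable S := by
      refine ⟨range D, countable_range D, fun x hx ↦ ?_⟩
      rw [EMetric.mem_closure_iff]
      intro ε hε
      obtain ⟨n, hn⟩ := hD x hx ε hε
      exact ⟨D n, mem_range_self n, (edist_le_arcEDist _ _).trans_lt hn⟩
    refine hS.union (IsSeparable.union (.iUnion fun i ↦ ?_)
      (.iUnion fun n ↦ .iUnion fun i ↦ .iUnion fun j ↦ ?_))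
    · exact isSeparable_range (joined_basePoint (D i)).somePath.continuous
    · exact isSeparable_range (continuous_shortPath _ _ _)
  · let _ : MeasurableSpace M := borel M
    have _ : BorelSpace M := ⟨rfl⟩
    exact measurable_concat (Continuous.measurable continuous_subtype_val) hmeas_a t
  · exact continuous_concat (hac x) (haa x) (hlim x)
  · refine concat_mem (mem_union_left _ x.2) (fun n s ↦ mem_union_right _ ?_) t
    rcases n with - | n
    · exact Or.inl (mem_iUnion.2 ⟨k x 0, mem_range_self s⟩)
    · exact Or.inr (mem_iUnion.2 ⟨n, mem_iUnion.2 ⟨k x n, mem_iUnion.2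
        ⟨k x (n + 1), mem_range_self s⟩⟩⟩)
  · simp only [concat_zero]
    have h0 : ∀ x, a x 0 0 = basePoint (D (k x 0)) := fun x ↦
      (joined_basePoint (D (k x 0))).somePath.source
    rw [h0, h0]
    -- The first approximation lies in the path component of `x`, so the starting point depends only
    -- on that component.
    exact basePoint_eq (((joined_of_arcEDist_lt (hk x 0)).symm.trans hxy).trans
      (joined_of_arcEDist_lt (hk y 0)))

end ArcLift

/-! ### Paths in locally connected complete metric spaces. -/

namespace ArcLift

variable {X : Type*} [MetricSpace X]

/-- The points `a` and `b` lie in a connected open subset of `U` of diameter at most `ε`. -/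
def Link (ε : ℝ) (U : Set X) (a b : X) : Prop :=
  ∃ W : Set X, IsOpen W ∧ IsPreconnected W ∧ W ⊆ U ∧ (∀ u ∈ W, ∀ v ∈ W, dist u v ≤ ε) ∧
    a ∈ W ∧ b ∈ W

namespace Link

variable {ε : ℝ} {U V : Set X} {a b : X}

theorem symm (h : Link ε U a b) : Link ε U b a :=
  let ⟨W, h1, h2, h3, h4, h5, h6⟩ := h
  ⟨W, h1, h2, h3, h4, h6, h5⟩

theorem mono (hUV : U ⊆ V) (h : Link ε U a b) : Link ε V a b :=
  let ⟨W, h1, h2, h3, h4⟩ := h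
  ⟨W, h1, h2, h3.trans hUV, h4⟩

theorem left_mem (h : Link ε U a b) : a ∈ U :=
  let ⟨_, _, _, h3, _, h5, _⟩ := h
  h3 h5

theorem dist_le (h : Link ε U a b) : dist a b ≤ ε :=
  let ⟨_, _, _, _, h4, h5, h6⟩ := h
  h4 _ h5 _ h6

theorem eventually [LocallyConnectedSpace X] (hε : 0 < ε) (hU : IsOpen U) (ha : a ∈ U) :
    ∀ᶠ b in 𝓝 a, Link ε U a b := by
  obtain ⟨W, hW, hWo, haW, hWc⟩ := locallyConnectedSpace_iff_subsets_isOpen_isConnected.1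
    ‹LocallyConnectedSpace X› a (U ∩ Metric.ball a (ε / 2))
    (Filter.inter_mem (hU.mem_nhds ha) (Metric.ball_mem_nhds a (half_pos hε)))
  filter_upwards [hWo.mem_nhds haW] with b hb
  refine ⟨W, hWo, hWc.isPreconnected, hW.trans inter_subset_left, fun u hu v hv ↦ ?_, haW, hb⟩
  have h1 : dist u a < ε / 2 := (hW hu).2
  have h2 : dist v a < ε / 2 := (hW hv).2
  linarith [dist_triangle_right u v a]

theorem refl [LocallyConnectedSpace X] (hε : 0 < ε) (hU : IsOpen U) (ha : a ∈ U) : Link ε U a a :=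
  (eventually hε hU ha).self_of_nhds

end Link

/-- Points near a given point of `U` are linked to it, so being joined by a chain is locally
constant on the connected set `U`. The constant continuation avoids any bookkeeping of lengths. -/
theorem exists_chain [LocallyConnectedSpace X] {ε : ℝ} (hε : 0 < ε) {U : Set X} (hU : IsOpen U)
    (hc : IsPreconnected U) {p q : X} (hp : p ∈ U) (hq : q ∈ U) :
    ∃ (c : ℕ → X) (K : ℕ), c 0 = p ∧ (∀ j ≥ K, c j = q) ∧ ∀ j, Link ε U (c j) (c (j + 1)) := by
  have h : Relation.ReflTransGen (Link ε U) p q := by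
    refine hc.induction₂ _ (fun x hx ↦ ?_) (fun x y z _ _ _ ↦ Relation.ReflTransGen.trans)
      (fun x y _ _ h ↦ ?_) hp hq
    · exact nhdsWithin_le_nhds ((Link.eventually hε hU hx).mono
        fun y hy ↦ Relation.ReflTransGen.single hy)
    · have : Std.Symm (Link ε U) := ⟨fun _ _ h ↦ h.symm⟩
      exact Relation.ReflTransGen.stdSymm.symm _ _ h
  clear hp
  induction h using Relation.ReflTransGen.head_induction_on with
  | refl => exact ⟨fun _ ↦ q, 0, rfl, fun _ _ ↦ rfl, fun _ ↦ Link.refl hε hU hq⟩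
  | @head a b hab _ ih =>
    obtain ⟨c, K, h0, hK, hl⟩ := ih
    refine ⟨fun j ↦ Nat.casesOn j a c, K + 1, rfl, ?_, ?_⟩
    · rintro (- | j) hj
      · omega
      · exact hK j (by omega)
    · rintro (- | j)
      · change Link ε U a (c 0)
        rwa [h0]
      · exact hl j

/-- A chain of `N` links in `U` from `x` to `y`, continued by the constant `y`. -/
structure IsLinkChain (U : Set X) (x y : X) (ε : ℝ) (N : ℕ) (g : ℕ → X) : Prop where
  pos : 0 < N
  zero : g 0 = x
  last : ∀ i ≥ N, g i = y
  link : ∀ i, Link ε U (g i) (g (i + 1))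

/-- Each link lies in a connected open set of diameter at most `ε`, within which it can be replaced
by a finer chain. Padding all pieces to a common length `K` keeps the new point `j` within `ε` of
the old point `j / K`. -/
theorem IsLinkChain.refine [LocallyConnectedSpace X] {U : Set X} (hU : IsOpen U) {x y : X} {ε : ℝ}
    {N : ℕ} {g : ℕ → X} (h : IsLinkChain U x y ε N g) {ε' : ℝ} (hε' : 0 < ε') :
    ∃ (K : ℕ) (g' : ℕ → X), 0 < K ∧ IsLinkChain U x y ε' (N * K) g' ∧
      ∀ j, dist (g (j / K)) (g' j) ≤ ε := by
  have hyU : y ∈ U := h.last N le_rfl ▸ (h.link N).left_mem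
  have key : ∀ i, ∃ (c : ℕ → X) (k : ℕ), c 0 = g i ∧ (∀ j ≥ k, c j = g (i + 1)) ∧
      (∀ j, Link ε' U (c j) (c (j + 1))) ∧ (∀ j, dist (g i) (c j) ≤ ε) ∧ (N ≤ i → k = 0) := by
    intro i
    by_cases hi : N ≤ i
    · have h0 : 0 ≤ ε := dist_nonneg.trans (h.link 0).dist_le
      refine ⟨fun _ ↦ y, 0, (h.last i hi).symm, fun _ _ ↦ (h.last _ (by omega)).symm,
        fun _ ↦ Link.refl hε' hU hyU, fun _ ↦ ?_, fun _ ↦ rfl⟩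
      rwa [h.last i hi, dist_self]
    · obtain ⟨W, hWo, hWc, hWU, hWd, h1, h2⟩ := h.link i
      obtain ⟨c, k, hc0, hck, hcl⟩ := exists_chain hε' hWo hWc h1 h2
      exact ⟨c, k, hc0, hck, fun j ↦ (hcl j).mono hWU,
        fun j ↦ hWd _ h1 _ (hcl j).left_mem, fun h' ↦ absurd h' hi⟩
  choose c k hc0 hck hcl hcd hk using key
  set K := 1 + ∑ i ∈ Finset.range N, k i with hK
  have hkK : ∀ i, k i ≤ K := fun i ↦ by
    rcases le_or_gt N i with hi | hi
    · rw [hk i hi]; exact Nat.zero_le _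
    · have := Finset.single_le_sum (f := k) (fun _ _ ↦ Nat.zero_le _) (Finset.mem_range.2 hi)
      omega
  have hK0 : 0 < K := by omega
  refine ⟨K, fun j ↦ c (j / K) (j % K), hK0, ⟨Nat.mul_pos h.pos hK0, ?_, fun i hi ↦ ?_,
    fun j ↦ ?_⟩, fun j ↦ hcd _ _⟩
  · simp only [Nat.zero_div, Nat.zero_mod, hc0, h.zero]
  · have hi' : N ≤ i / K := (Nat.le_div_iff_mul_le hK0).2 hi
    change c (i / K) (i % K) = y
    rw [hck _ _ (by rw [hk _ hi']; exact Nat.zero_le _), h.last _ (by omega)]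
  · have hdm := Nat.div_add_mod j K
    have hlt := Nat.mod_lt j hK0
    -- Either `j + 1` stays in the block of `j`, or it opens the next one; in that case the padded
    -- piece has already reached the next point by step `K`.
    rcases (Nat.succ_le_of_lt hlt).lt_or_eq with hlt' | heq
    · obtain ⟨e1, e2⟩ := (Nat.div_mod_unique (a := j + 1) (d := j / K) (c := j % K + 1) hK0).2
        ⟨by omega, hlt'⟩
      rw [e1, e2]
      exact hcl _ _
    · obtain ⟨e1, e2⟩ := (Nat.div_mod_unique (a := j + 1) (d := j / K + 1) (c := 0) hK0).2
        ⟨by rw [mul_add, mul_one]; omega, hK0⟩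
      rw [e1, e2, hc0, ← hck (j / K) (j % K + 1) (by rw [← Nat.succ_eq_add_one, heq]; exact hkK _)]
      exact hcl _ _

theorem exists_chain_seq [LocallyConnectedSpace X] {U : Set X} (hU : IsOpen U)
    (hc : IsPreconnected U) {x y : X} (hx : x ∈ U) (hy : y ∈ U) :
    ∃ (N K : ℕ → ℕ) (g : ℕ → ℕ → X), (∀ n, 0 < K n) ∧ (∀ n, N (n + 1) = N n * K n) ∧
      (∀ n, IsLinkChain U x y ((1 / 2 : ℝ) ^ n) (N n) (g n)) ∧
      ∀ n j, dist (g n (j / K n)) (g (n + 1) j) ≤ (1 / 2 : ℝ) ^ n := by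
  have hstart : ∃ (N : ℕ) (g : ℕ → X), IsLinkChain U x y ((1 / 2 : ℝ) ^ 0) N g := by
    obtain ⟨c, K, h0, hK, hl⟩ := exists_chain (ε := (1 / 2 : ℝ) ^ 0) (by norm_num) hU hc hx hy
    exact ⟨K + 1, c, K.succ_pos, h0, fun i hi ↦ hK i (by omega), hl⟩
  obtain ⟨N₀, g₀, h₀⟩ := hstart
  let T : ℕ → Type _ := fun n ↦
    {p : ℕ × (ℕ → X) // IsLinkChain U x y ((1 / 2 : ℝ) ^ n) p.1 p.2}
  have step : ∀ (n : ℕ) (p : T n), ∃ (K : ℕ) (p' : T (n + 1)), 0 < K ∧ p'.1.1 = p.1.1 * K ∧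
      ∀ j, dist (p.1.2 (j / K)) (p'.1.2 j) ≤ (1 / 2 : ℝ) ^ n := fun n p ↦ by
    obtain ⟨K, g', hK, hg', hd⟩ := p.2.refine hU (ε' := (1 / 2 : ℝ) ^ (n + 1)) (by positivity)
    exact ⟨K, ⟨(p.1.1 * K, g'), hg'⟩, hK, rfl, hd⟩
  choose K next hK hN hd using step
  let p : ∀ n, T n := fun n ↦ Nat.rec ⟨(N₀, g₀), h₀⟩ next n
  exact ⟨fun n ↦ (p n).1.1, fun n ↦ K n (p n), fun n ↦ (p n).1.2, fun n ↦ hK n (p n),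
    fun n ↦ hN n (p n), fun n ↦ (p n).2, fun n ↦ hd n (p n)⟩

/-- Two points of a connected open subset of a locally connected complete metric space are joined by
a path in its closure. -/
theorem joinedIn_closure [CompleteSpace X] [LocallyConnectedSpace X] {U : Set X} (hU : IsOpen U)
    (hc : IsPreconnected U) {x y : X} (hx : x ∈ U) (hy : y ∈ U) : JoinedIn (closure U) x y := by
  obtain ⟨N, K, g, hK, hN, hg, hd⟩ := exists_chain_seq hU hc hx hy
  -- Step functions along the chains. Since `N (n + 1) = N n * K n`, the subdivisions are nested and
  -- the refinement bound makes the sequence uniformly Cauchy.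
  let f : ℕ → unitInterval → X := fun n t ↦ g n ⌊(N n : ℝ) * t⌋₊
  have hfd : ∀ t n, dist (f n t) (f (n + 1) t) ≤ 1 * (1 / 2 : ℝ) ^ n := by
    intro t n
    have hKn : (K n : ℝ) ≠ 0 := by exact_mod_cast (hK n).ne'
    have : ⌊(N n : ℝ) * t⌋₊ = ⌊(N (n + 1) : ℝ) * t⌋₊ / K n := by
      rw [← Nat.floor_div_natCast, hN, Nat.cast_mul]
      congr 1
      field_simp
    rw [one_mul]
    simp only [f]
    rw [this]
    exact hd n _
  have hlim : ∀ t, ∃ z, Filter.Tendsto (fun n ↦ f n t) Filter.atTop (𝓝 z) := fun t ↦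
    cauchySeq_tendsto_of_complete
      (cauchySeq_of_le_geometric (1 / 2 : ℝ) 1 (by norm_num) (hfd t))
  choose F hF using hlim
  have hfF : ∀ n t, dist (f n t) (F t) ≤ 2 * (1 / 2 : ℝ) ^ n := fun n t ↦ by
    have := dist_le_of_le_geometric_of_tendsto (1 / 2 : ℝ) 1 (by norm_num) (hfd t) (hF t) n
    refine this.trans_eq ?_
    ring
  -- Times closer than `1 / N n` have indices differing by at most one, that is, by at most one
  -- link.
  have hosc : ∀ n (s t : unitInterval), s ≤ t → dist s t < 1 / (N n : ℝ) →
      dist (f n s) (f n t) ≤ (1 / 2 : ℝ) ^ n := by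
    intro n s t hst hd
    have hN0 : (0 : ℝ) < N n := by exact_mod_cast (hg n).pos
    have hst' : (s : ℝ) ≤ t := hst
    rw [Subtype.dist_eq, dist_comm, Real.dist_eq, abs_of_nonneg (sub_nonneg.2 hst'),
      lt_div_iff₀ hN0] at hd
    have h1 : ⌊(N n : ℝ) * s⌋₊ ≤ ⌊(N n : ℝ) * t⌋₊ := Nat.floor_mono (by gcongr)
    have h2 : ⌊(N n : ℝ) * t⌋₊ < ⌊(N n : ℝ) * s⌋₊ + 2 := by
      rw [Nat.floor_lt (mul_nonneg hN0.le t.2.1)]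
      push_cast
      have := Nat.lt_floor_add_one ((N n : ℝ) * s)
      linarith
    rcases (show ⌊(N n : ℝ) * t⌋₊ = ⌊(N n : ℝ) * s⌋₊ ∨
        ⌊(N n : ℝ) * t⌋₊ = ⌊(N n : ℝ) * s⌋₊ + 1 by omega) with e | e
    · simp only [f, e, dist_self]
      positivity
    · simp only [f, e]
      exact ((hg n).link _).dist_le
  have hFc : Continuous F := by
    refine UniformContinuous.continuous (Metric.uniformContinuous_iff.2 fun ε hε ↦ ?_)
    -- The fifth is `2 + 1 + 2`: two uniform approximation errors and one oscillation, in units of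
    -- `(1 / 2) ^ n`.
    obtain ⟨n, hn⟩ := exists_pow_lt_of_lt_one (show 0 < ε / 5 by linarith)
      (show (1 / 2 : ℝ) < 1 by norm_num)
    have hN0 : (0 : ℝ) < N n := by exact_mod_cast (hg n).pos
    refine ⟨1 / N n, by positivity, fun {s t} hst ↦ ?_⟩
    have h3 : dist (f n s) (f n t) ≤ (1 / 2 : ℝ) ^ n := by
      rcases le_total s t with h | h
      · exact hosc n s t h hst
      · rw [dist_comm]
        exact hosc n t s h (by rwa [dist_comm])
    have h1 := hfF n s
    have h2 := hfF n t
    rw [dist_comm] at h1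
    linarith [dist_triangle4 (F s) (f n s) (f n t) (F t)]
  have hF0 : F 0 = x := by
    refine tendsto_nhds_unique (hF 0) (tendsto_const_nhds.congr fun n ↦ ?_)
    simp [f, (hg n).zero]
  have hF1 : F 1 = y := by
    refine tendsto_nhds_unique (hF 1) (tendsto_const_nhds.congr fun n ↦ ?_)
    simp [f, (hg n).last]
  refine ⟨⟨⟨F, hFc⟩, hF0, hF1⟩, fun t ↦ ?_⟩
  exact mem_closure_of_tendsto (hF t) (Filter.Eventually.of_forall fun n ↦
    ((hg n).link _).left_mem)

end ArcLift

/-! ### Borel measurability of the balls, and the three statements. -/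

namespace ArcLift

open MeasureTheory

theorem polishSpace_continuousMap (X : Type*) [TopologicalSpace X] [PolishSpace X] :
    PolishSpace C(unitInterval, X) := by
  let _ := upgradeIsCompletelyMetrizable X
  infer_instance

section Analytic

variable {X : Type*} [MetricSpace X]

theorem isClosed_setOf_ediam_range_le (r : ℝ≥0∞) :
    IsClosed {γ : C(unitInterval, X) | Metric.ediam (range γ) ≤ r} := by
  have : {γ : C(unitInterval, X) | Metric.ediam (range γ) ≤ r} =
      ⋂ (s : unitInterval) (t : unitInterval), {γ | edist (γ s) (γ t) ≤ r} := by
    ext γ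
    simp only [mem_ofPred_eq, Metric.ediam_le_iff, forall_mem_range, mem_iInter]
  rw [this]
  refine isClosed_iInter fun s ↦ isClosed_iInter fun t ↦ isClosed_le ?_ continuous_const
  exact (continuous_eval_const s).edist (continuous_eval_const t)

/-- The ball is the image, under evaluation at `0`, of a Borel set of paths in the Polish space
`C(unitInterval, X)`. -/
theorem analyticSet_arcEDist_lt [PolishSpace X] (x : X) (r : ℝ≥0∞) :
    AnalyticSet {y | arcEDist y x < r} := by
  have _ := polishSpace_continuousMap X
  borelize C(unitInterval, X)
  have hd : Measurable fun γ : C(unitInterval, X) ↦ Metric.ediam (range γ) :=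
    measurable_of_Iic fun r ↦ (isClosed_setOf_ediam_range_le r).measurableSet
  have hm : MeasurableSet {γ : C(unitInterval, X) | γ 1 = x ∧ Metric.ediam (range γ) < r} :=
    (isClosed_eq (continuous_eval_const 1) continuous_const).measurableSet.inter
      (measurableSet_lt hd measurable_const)
  convert hm.analyticSet.image_of_continuous
    (continuous_eval_const (F := C(unitInterval, X)) (0 : unitInterval)) using 1
  ext y
  simp only [mem_ofPred_eq, arcEDist_lt_iff, mem_image]
  constructor
  · rintro ⟨γ, hγ⟩
    exact ⟨γ.toContinuousMap, ⟨γ.target, hγ⟩, γ.source⟩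
  · rintro ⟨γ, ⟨h1, hγ⟩, h0⟩
    exact ⟨⟨γ, h0, h1⟩, hγ⟩

/-- Relative to a set that is separable for the canonical arc-topology, the balls around the points
of a dense sequence are Borel for the original topology. -/
theorem measurableSet_arcEDist_lt [PolishSpace X] {S : Set X} {D : ℕ → X}
    (hD : ∀ x ∈ S, ∀ r > 0, ∃ n, arcEDist x (D n) < r) (n : ℕ) (r : ℝ≥0∞) :
    @MeasurableSet S (borel S) {x | arcEDist (x : X) (D n) < r} := by
  borelize X
  let _ : MeasurableSpace S := borel S
  have _ : BorelSpace S := ⟨rfl⟩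
  -- `B` is an analytic set disjoint from the ball and containing the points of `S` outside it: `y`
  -- is approximated by points `D m` that are nearly at distance `r` or more from `D n`. A Borel set
  -- separating the ball from `B` then has the right trace on `S`. For `k = 0` the inverse is `∞`
  -- and the condition on `m` is void.
  let B : Set X := ⋂ k : ℕ, ⋃ m : {m : ℕ // r ≤ arcEDist (D m) (D n) + (k : ℝ≥0∞)⁻¹},
    {y | arcEDist y (D m) < (k : ℝ≥0∞)⁻¹}
  have hB : AnalyticSet B := AnalyticSet.iInter fun k ↦ AnalyticSet.iUnion fun m ↦
    analyticSet_arcEDist_lt _ _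
  have hdisj : Disjoint {y | arcEDist y (D n) < r} B := by
    refine disjoint_left.2 fun y hy hyB ↦ not_le.2 (show arcEDist y (D n) < r from hy) ?_
    have ht : Filter.Tendsto (fun k : ℕ ↦ (k : ℝ≥0∞)⁻¹ + arcEDist y (D n) + (k : ℝ≥0∞)⁻¹)
        Filter.atTop (𝓝 (0 + arcEDist y (D n) + 0)) :=
      (ENNReal.tendsto_inv_nat_nhds_zero.add tendsto_const_nhds).add
        ENNReal.tendsto_inv_nat_nhds_zero
    rw [zero_add, add_zero] at ht
    refine ge_of_tendsto' ht fun k ↦ ?_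
    obtain ⟨⟨m, hm⟩, hym⟩ := mem_iUnion.1 (mem_iInter.1 hyB k)
    refine hm.trans ?_
    gcongr
    refine (arcEDist_triangle _ y _).trans ?_
    rw [arcEDist_comm _ y]
    gcongr
    exact hym.le
  obtain ⟨u, hAu, hBu, hu⟩ := (analyticSet_arcEDist_lt (D n) r).measurablySeparable hB hdisj
  suffices hSu : {x : S | arcEDist (x : X) (D n) < r} = Subtype.val ⁻¹' u by
    rw [hSu]
    exact measurableSet_preimage (Continuous.measurable continuous_subtype_val) hu
  ext x
  refine ⟨fun hx ↦ hAu hx, fun hx ↦ by_contra fun hr ↦ ?_⟩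
  refine disjoint_left.1 hBu (mem_iInter.2 fun k ↦ ?_) hx
  obtain ⟨m, hm⟩ := hD x x.2 (k : ℝ≥0∞)⁻¹ (by simp)
  refine mem_iUnion.2 ⟨⟨m, (not_lt.1 hr).trans ?_⟩, hm⟩
  refine (arcEDist_triangle _ (D m) _).trans ?_
  rw [add_comm]
  gcongr

end Analytic

theorem isOpen_arcEDist_lt {X : Type*} [MetricSpace X]
    (h : ∀ (x : X), ∀ r > 0, {y | arcEDist y x < r} ∈ 𝓝 x) (z : X) (r : ℝ≥0∞) :
    IsOpen {y | arcEDist y z < r} := by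
  rw [isOpen_iff_mem_nhds]
  intro x hx
  obtain ⟨ε, hε, hlt⟩ := ENNReal.lt_iff_exists_add_pos_lt.1 hx
  filter_upwards [h x ε (by exact_mod_cast hε)] with y hy
  refine (arcEDist_triangle y x z).trans_lt (lt_of_le_of_lt ?_ hlt)
  rw [add_comm]
  gcongr

/-- Closed balls are used because `joinedIn_closure` provides paths only in the closure of a
connected open set. -/
theorem arcEDist_lt_mem_nhds_of_subset {X : Type*} [MetricSpace X] {x : X} {r : ℝ≥0∞} (hr : 0 < r)
    (h : ∀ ε : ℝ≥0∞, 0 < ε → ∃ V ∈ 𝓝 x, ∀ y ∈ V, JoinedIn (Metric.closedEBall x ε) y x) :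
    {y | arcEDist y x < r} ∈ 𝓝 x := by
  obtain ⟨ε, hε, hεr⟩ : ∃ ε : ℝ≥0∞, 0 < ε ∧ 2 * ε < r := by
    obtain ⟨q, hq, hqr⟩ := exists_between hr
    refine ⟨q / 2, ENNReal.half_pos hq.ne', ?_⟩
    rwa [ENNReal.mul_div_cancel (by simp) (by simp)]
  obtain ⟨V, hV, hVj⟩ := h ε hε
  filter_upwards [hV] with y hy
  obtain ⟨γ, hγ⟩ := hVj y hy
  refine arcEDist_lt_iff.2 ⟨γ, lt_of_le_of_lt ?_ hεr⟩
  exact (Metric.ediam_mono (range_subset_iff.2 hγ)).trans Metric.ediam_closedEBall_le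

theorem IsLocallyArcConnected.arcEDist_lt_mem_nhds {X : Type*} [MetricSpace X]
    (h : IsLocallyArcConnected X) (x : X) (r : ℝ≥0∞) (hr : r > 0) :
    {y | arcEDist y x < r} ∈ 𝓝 x := by
  refine arcEDist_lt_mem_nhds_of_subset hr fun ε hε ↦ ?_
  obtain ⟨V, hVo, hxV, hV, hVa⟩ := h x (Metric.eball x ε) Metric.isOpen_eball
    (Metric.mem_eball_self hε)
  exact ⟨V, hVo.mem_nhds hxV, fun y hy ↦
    (hVa y hy x hxV).joinedIn.mono (hV.trans Metric.eball_subset_closedEBall)⟩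

theorem arcEDist_lt_mem_nhds {X : Type*} [MetricSpace X] [CompleteSpace X]
    [LocallyConnectedSpace X] (x : X) (r : ℝ≥0∞) (hr : r > 0) :
    {y | arcEDist y x < r} ∈ 𝓝 x := by
  refine arcEDist_lt_mem_nhds_of_subset hr fun ε hε ↦ ?_
  obtain ⟨V, hV, hVo, hxV, hVc⟩ := locallyConnectedSpace_iff_subsets_isOpen_isConnected.1
    ‹LocallyConnectedSpace X› x _ (Metric.eball_mem_nhds x hε)
  refine ⟨V, hVo.mem_nhds hxV, fun y hy ↦ (joinedIn_closure hVo hVc.isPreconnected hy hxV).mono ?_⟩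
  exact closure_minimal (hV.trans Metric.eball_subset_closedEBall) Metric.isClosed_closedEBall

theorem joined_of_mem_arcRel {X : Type*} [TopologicalSpace X] {x y : X} (h : (x, y) ∈ arcRel X) :
    Joined x y :=
  (ArcJoinedIn.joinedIn h).joined

theorem hasBorelArcLifting_of_dense {X : Type*} [MetricSpace X] [SecondCountableTopology X]
    {S : Set X} (D : ℕ → X) (hD : ∀ x ∈ S, ∀ r > 0, ∃ n, arcEDist x (D n) < r)
    (hmeas : ∀ n r, @MeasurableSet S (borel S) {x | arcEDist (x : X) (D n) < r}) :
    HasBorelArcLifting X S := by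
  obtain ⟨N, c, -, -, hm, hc, h1, -, h0⟩ := exists_measurable_paths D hD hmeas
  exact hasBorelArcLifting_of_paths c hm hc h1 fun x y h ↦ h0 x y (joined_of_mem_arcRel h)

theorem hasBorelArcLifting_of_isSeparable_arcTopology (X : Type*) [MetricSpace X] [PolishSpace X]
    (x₀ : X) (S : Set X) (hS : @IsSeparable X (arcTopology X) S) : HasBorelArcLifting X S := by
  obtain ⟨s, hs, hSs⟩ := hS
  -- Adding `x₀` makes the countable set nonempty, so that a sequence enumerates it.
  obtain ⟨D, hDs⟩ := (hs.insert x₀).exists_eq_range (insert_nonempty _ _)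
  have hD : ∀ x ∈ S, ∀ r > 0, ∃ n, arcEDist x (D n) < r := by
    intro x hx r hr
    -- The minimum with `1` is needed since only balls of finite radius generate the arc-topology.
    have hopen : IsOpen[arcTopology X] {y | arcEDist x y < min r 1} :=
      isOpen_generateFrom_of_mem ⟨x, min r 1, (min_lt_of_right_lt ENNReal.one_lt_top).ne, rfl⟩
    have hx' : x ∈ {y | arcEDist x y < min r 1} := by
      rw [mem_ofPred_eq, arcEDist_self]
      exact lt_min hr one_pos
    obtain ⟨d, hd, hds⟩ := (@mem_closure_iff X (arcTopology X) _ _).1 (hSs hx) _ hopen hx'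
    obtain ⟨n, rfl⟩ : d ∈ range D := hDs ▸ mem_insert_of_mem _ hds
    exact ⟨n, lt_of_lt_of_le hd (min_le_left _ _)⟩
  exact hasBorelArcLifting_of_dense D hD (measurableSet_arcEDist_lt hD)

theorem hasBorelArcLifting_of_isEmpty (X : Type*) [TopologicalSpace X] [IsEmpty X] (S : Set X) :
    HasBorelArcLifting X S := by
  have : IsEmpty ↥((S ×ˢ S) ∩ arcRel X) := ⟨fun p ↦ isEmptyElim p.1.1⟩
  exact ⟨isEmptyElim, isEmptyElim, @measurable_of_empty _ _ (borel _) (borel _) _ _⟩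

theorem hasBorelArcLifting_of_locallyConnectedSpace (X : Type*) [TopologicalSpace X]
    [PolishSpace X] [LocallyConnectedSpace X] : HasBorelArcLifting X univ := by
  rcases isEmpty_or_nonempty X with _ | _
  · exact hasBorelArcLifting_of_isEmpty X _
  let _ := upgradeIsCompletelyMetrizable X
  have hn := arcEDist_lt_mem_nhds (X := X)
  have ho := isOpen_arcEDist_lt hn
  refine hasBorelArcLifting_of_dense (denseSeq X) (fun x _ r hr ↦ ?_) fun n r ↦ ?_
  · obtain ⟨n, hn⟩ := (denseRange_denseSeq X).exists_mem_open (ho x r)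
      ⟨x, mem_of_mem_nhds (hn x r hr)⟩
    exact ⟨n, by rw [arcEDist_comm]; exact hn⟩
  · let _ : MeasurableSpace (univ : Set X) := borel _
    have _ : BorelSpace (univ : Set X) := ⟨rfl⟩
    exact ((ho (denseSeq X n) r).preimage continuous_subtype_val).measurableSet

theorem exists_separable_hasBorelArcLifting (M : Type*) [MetricSpace M]
    (hM : IsArcConnected (univ : Set M)) (hloc : IsLocallyArcConnected M) (S : Set M)
    (hS : IsSeparable S) :
    ∃ N : Set M, S ⊆ N ∧ IsSeparable N ∧
      ((Subtype.val ⁻¹' S : Set ↥N) ×ˢ (Subtype.val ⁻¹' S : Set ↥N) ⊆ arcRel ↥N) ∧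
      HasBorelArcLifting ↥N (Subtype.val ⁻¹' S) := by
  rcases isEmpty_or_nonempty M with hE | ⟨⟨x₀⟩⟩
  · exact ⟨S, Subset.rfl, hS, fun p ↦ isEmptyElim p.1.1, hasBorelArcLifting_of_isEmpty _ _⟩
  obtain ⟨s, hs, hSs⟩ := hS
  obtain ⟨D, hDs⟩ := (hs.insert x₀).exists_eq_range (insert_nonempty _ _)
  have hn := hloc.arcEDist_lt_mem_nhds
  have ho := isOpen_arcEDist_lt hn
  have hD : ∀ x ∈ S, ∀ r > 0, ∃ n, arcEDist x (D n) < r := by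
    intro x hx r hr
    obtain ⟨d, hd, hds⟩ := mem_closure_iff.1 (hSs hx) _ (ho x r) (mem_of_mem_nhds (hn x r hr))
    obtain ⟨n, rfl⟩ : d ∈ range D := hDs ▸ mem_insert_of_mem _ hds
    exact ⟨n, by rw [arcEDist_comm]; exact hd⟩
  obtain ⟨N, c, hSN, hN, hm, hc, h1, hcN, h0⟩ := exists_measurable_paths D hD fun n r ↦ by
    let _ : MeasurableSpace S := borel S
    have _ : BorelSpace S := ⟨rfl⟩
    exact ((ho (D n) r).preimage continuous_subtype_val).measurableSet
  -- Arc-connectedness of `M` gives one base point for all of `S`. The paths run in `N`, so they can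
  -- be concatenated and loop-erased in that subspace.
  have hcc : ∀ x y : S, c x 0 = c y 0 := fun x y ↦
    h0 x y (hM x trivial y trivial).joinedIn.joined
  let ι : ↥(Subtype.val ⁻¹' S : Set ↥N) → S := fun x ↦ ⟨x.1.1, x.2⟩
  let c' : ↥(Subtype.val ⁻¹' S : Set ↥N) → unitInterval → N := fun x t ↦ ⟨c (ι x) t, hcN _ t⟩
  have hc' : ∀ x, Continuous (c' x) := fun x ↦ (hc _).subtype_mk _
  have h1' : ∀ x, c' x 1 = x := fun x ↦ Subtype.ext (h1 _)
  have h0' : ∀ x y, c' x 0 = c' y 0 := fun x y ↦ Subtype.ext (hcc _ _)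
  have _ := hN.separableSpace
  have _ := UniformSpace.secondCountable_of_separable N
  refine ⟨N, hSN, hN, fun p hp ↦ ?_, hasBorelArcLifting_of_paths c' (fun t ↦ ?_) hc' h1'
    fun x y _ ↦ h0' x y⟩
  · have hγ : ∀ x, Joined (c' x 0) (x : N) := fun x ↦ ⟨⟨⟨c' x, hc' x⟩, rfl, h1' x⟩⟩
    have h2 := hγ ⟨p.2, hp.2⟩
    rw [h0' _ ⟨p.1, hp.1⟩] at h2
    exact arcJoinedIn_iff.2 (joinedIn_univ.2 ((hγ ⟨p.1, hp.1⟩).symm.trans h2))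
  · borelize M
    let _ : MeasurableSpace S := borel S
    have _ : BorelSpace S := ⟨rfl⟩
    let _ : MeasurableSpace ↥(Subtype.val ⁻¹' S : Set ↥N) := borel _
    have _ : BorelSpace ↥(Subtype.val ⁻¹' S : Set ↥N) := ⟨rfl⟩
    have hι : Measurable ι := Continuous.measurable (by fun_prop)
    have hmt : Measurable fun x ↦ c x t := by
      have := hm t
      rwa [IsBorelMap, ← BorelSpace.measurable_eq (α := M)] at this
    have := (hmt.comp hι).subtype_mk (h := fun x ↦ hcN (ι x) t)
    rw [IsBorelMap, ← BorelSpace.measurable_eq (α := N)]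
    exact this

end ArcLift

theorem mainTheorem10 :
    -- separable subsets of complete, arc-connected, locally arc-connected metric spaces
    (∀ (M : Type*) [MetricSpace M] [CompleteSpace M],
      ArcLift.IsArcConnected (Set.univ : Set M) → ArcLift.IsLocallyArcConnected M →
      ∀ S : Set M, TopologicalSpace.IsSeparable S →
        ∃ N : Set M, S ⊆ N ∧ TopologicalSpace.IsSeparable N ∧
          ((Subtype.val ⁻¹' S : Set ↥N) ×ˢ (Subtype.val ⁻¹' S : Set ↥N) ⊆ ArcLift.arcRel ↥N) ∧
          ArcLift.HasBorelArcLifting ↥N (Subtype.val ⁻¹' S)) ∧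
    -- subsets of an arc-component that are separable for the arc-topology
    (∀ (X : Type*) [MetricSpace X] [PolishSpace X] (x₀ : X) (S : Set X),
      S ⊆ ArcLift.arcComponent x₀ →
      @TopologicalSpace.IsSeparable X (ArcLift.arcTopology X) S →
        ArcLift.HasBorelArcLifting X S) ∧
    -- locally connected Polish spaces
    (∀ (X : Type*) [TopologicalSpace X] [PolishSpace X] [LocallyConnectedSpace X],
      ArcLift.HasBorelArcLifting X (Set.univ : Set X)) :=
  ⟨fun M _ _ hM hloc S hS ↦ ArcLift.exists_separable_hasBorelArcLifting M hM hloc S hS,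
    fun X _ _ x₀ S _ hS ↦ ArcLift.hasBorelArcLifting_of_isSeparable_arcTopology X x₀ S hS,
    fun X _ _ _ ↦ ArcLift.hasBorelArcLifting_of_locallyConnectedSpace X⟩
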